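/- Let $F$ be a definite quaternion algebra over $\mathbf{Q}$, i.e. a skew field with center $\mathbf{Q}$, of dimension $4$ over $\mathbf{Q}$, such that $F\otimes_{\mathbf{Q}}\mathbf{R}$ is isomorphic to Hamilton's quaternions, and let $x\mapsto\bar x$ be its canonical involution. Let $(A,E)$ be a polarized complex abelian variety of dimension $2n$, of quaternion type with algebra $F$; that is, there is an inclusion of $\mathbf{Q}$-algebras $F\subset \mathrm{End}(A)\otimes\mathbf{Q}$ (so that $H_1(A,\mathbf{Q})$ is a vector space over $F$) such that $x^*E=x\bar x\,E$ for all $x\in F$. The elements $x\in F$ act on $H^{2n}(A,\mathbf{Q})=\wedge^{2n}H^1(A,\mathbf{Q})$ through $\wedge^{2n}$ of their action on $H^1(A,\mathbf{Q})$. For a quadratic subfield $K\subset F$ with complex embeddings $\sigma,\bar\sigma$ and for $x\in K$, let $f_x=(T-\sigma(x)^{2n})(T-\bar\sigma(x)^{2n})\in\mathbf{Q}[T]$, let $W_x\subset H^{2n}(A,\mathbf{Q})$ be the kernel of $f_x$ evaluated at the action of $x$ on $H^{2n}(A,\mathbf{Q})$, and let $$W_K=\bigcap_{x\in K}W_x\subset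 H^{2n}(A,\mathbf{Q})$$ be the space of Weil classes for $K$. Let $W_F\subset H^{2n}(A,\mathbf{Q})$ be the $\mathbf{Q}$-subspace spanned by the translates $x\cdot W_K$, where $x$ runs over $F$. Then $W_F$ does not depend on the choice of the quadratic subfield $K\subset F$, and $$W_F\subset H^{2n}(A,\mathbf{Q})\cap H^{n,n}(A),\qquad \dim_{\mathbf{Q}}W_F=2n+1.$$ -/

import Mathlib

open scoped TensorProduct

noncomputable section

/-! ### Definite quaternion algebras over `ℚ` -/

/-- A definite quaternion algebra over `ℚ`: a skew field with centre `ℚ`, of dimension `4` over `ℚ`,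
such that `ℝ ⊗ F` is isomorphic to Hamilton's quaternions. -/
structure IsDefiniteQuaternionAlgebra (F : Type*) [Ring F] [Algebra ℚ F] : Prop where
  isUnit_of_ne_zero : ∀ x : F, x ≠ 0 → IsUnit x
  isCentral : Algebra.IsCentral ℚ F
  finrank_eq : Module.finrank ℚ F = 4
  definite : Nonempty ((ℝ ⊗[ℚ] F) ≃ₐ[ℝ] Quaternion ℝ)

/-- The canonical involution `x ↦ x̄ = trd x - x` of a quaternion algebra. The reduced trace `trd x`
is half of the trace of multiplication by `x` on the four-dimensional space `F`; for
`x = a + b i + c j + d k` this gives `x̄ = a - b i - c j - d k`. -/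
def quaternionConj {F : Type*} [Ring F] [Algebra ℚ F] (x : F) : F :=
  algebraMap ℚ F (LinearMap.trace ℚ F (LinearMap.mulLeft ℚ x) / 2) - x

/-- A subfield of `F` which is a quadratic extension of `ℚ`. -/
structure IsQuadraticSubfield {F : Type*} [Ring F] [Algebra ℚ F] (K : Subalgebra ℚ F) : Prop where
  isField : IsField K
  finrank_eq : Module.finrank ℚ K = 2

/-! ### Complex tori `A = V / Λ`, their endomorphisms and polarizations -/

section Torus

variable {V : Type*} [NormedAddCommGroup V] [NormedSpace ℂ V] (Λ : Submodule ℤ V)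

/-- `End(A)` for the complex torus `A = V / Λ`: the `ℂ`-linear endomorphisms of the tangent space
`V = T₀A` that map the lattice `Λ` into itself. -/
def torusEnd : Subring (Module.End ℂ V) where
  carrier := {φ | ∀ v ∈ Λ, φ v ∈ Λ}
  mul_mem' := fun ha hb v hv => ha _ (hb v hv)
  one_mem' := fun _ hv => hv
  add_mem' := fun ha hb v hv => Λ.add_mem (ha v hv) (hb v hv)
  zero_mem' := fun _ _ => Λ.zero_mem
  neg_mem' := fun ha v hv => Λ.neg_mem (ha v hv)

/-- `End(A) ⊗ ℚ`. -/
abbrev torusEndQ : Type _ := ℚ ⊗[ℤ] torusEnd Λ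

/-- `H₁(A, ℚ) = ℚ ⊗ H₁(A, ℤ)` with `H₁(A, ℤ) = Λ`. -/
abbrev torusH1Q : Type _ := ℚ ⊗[ℤ] Λ

/-- The action of `End(A)` on `H₁(A, ℤ) = Λ`. -/
def integralRep : torusEnd Λ →ₐ[ℤ] Module.End ℤ Λ :=
  RingHom.toIntAlgHom
    { toFun := fun φ => (φ.1.restrictScalars ℤ).restrict φ.2
      map_one' := rfl
      map_mul' := fun _ _ => rfl
      map_zero' := rfl
      map_add' := fun _ _ => rfl }

/-- The action of `End(A) ⊗ ℚ` on `H₁(A, ℚ)`, where `q ⊗ φ` sends `r ⊗ v` to `q r ⊗ φ v`. -/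
def rationalRep : torusEndQ Λ →ₐ[ℚ] Module.End ℚ (torusH1Q Λ) :=
  Algebra.TensorProduct.lift (Algebra.ofId ℚ _)
    ((Module.End.baseChangeHom ℤ ℚ Λ).comp (integralRep Λ))
    (fun q _ => Algebra.commutes q _)

/-- A polarization of `A = V / Λ`: a Riemann form, that is, an alternating form `E` with integral
values on `Λ` whose real-bilinear extension to `V` satisfies `E(iv, iw) = E(v, w)` and
`E(v, iv) > 0` for `v ≠ 0`. -/
structure Polarization where
  form : LinearMap.BilinForm ℤ Λ
  realForm : LinearMap.BilinForm ℝ V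
  realForm_coe : ∀ v w : Λ, realForm v w = (form v w : ℝ)
  alternating : realForm.IsAlt
  map_I : ∀ v w : V, realForm (Complex.I • v) (Complex.I • w) = realForm v w
  pos : ∀ v : V, v ≠ 0 → 0 < realForm v (Complex.I • v)

variable {Λ}

/-- `E` as a form on `H₁(A, ℚ)`. -/
def Polarization.formQ (E : Polarization Λ) : LinearMap.BilinForm ℚ (torusH1Q Λ) :=
  E.form.baseChange ℚ

/-- `(A, E, F)` is a polarized abelian variety of quaternion type, where `ι` is the inclusion
`F ⊂ End(A) ⊗ ℚ`: `F` is a definite quaternion algebra and `x^* E = x x̄ E` for all `x ∈ F`.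
(Since `ι` is unital, `H₁(A, ℚ)` is a vector space over `F`.) -/
structure IsQuaternionType (E : Polarization Λ) {F : Type*} [Ring F] [Algebra ℚ F]
    (ι : F →ₐ[ℚ] torusEndQ Λ) : Prop where
  definite : IsDefiniteQuaternionAlgebra F
  injective : Function.Injective ι
  pullback_form : ∀ (x : F) (c : ℚ), algebraMap ℚ F c = x * quaternionConj x →
    ∀ v w : torusH1Q Λ,
      E.formQ (rationalRep Λ (ι x) v) (rationalRep Λ (ι x) w) = c * E.formQ v w

variable (Λ)

/-! ### Cohomology of `A = V / Λ` and its Hodge decomposition -/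

/-- `H¹(A, ℚ)`, the dual of `H₁(A, ℚ)`. -/
abbrev torusCohQ1 : Type _ := Module.Dual ℚ (torusH1Q Λ)

/-- `H^k(A, ℚ) = ⋀^k H¹(A, ℚ)`. -/
abbrev torusCohQ (k : ℕ) : Type _ := ⋀[ℚ]^k (torusCohQ1 Λ)

/-- `H¹(A, ℂ) = Hom(Λ, ℂ)`. -/
abbrev torusCohC1 : Type _ := Λ →ₗ[ℤ] ℂ

/-- `H^k(A, ℂ) = ⋀^k H¹(A, ℂ)`. -/
abbrev torusCohC (k : ℕ) : Type _ := ⋀[ℂ]^k (torusCohC1 Λ)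

/-- The inclusion `H¹(A, ℚ) → H¹(A, ℂ)`. -/
def cohQ1ToC1 : torusCohQ1 Λ →ₗ[ℚ] torusCohC1 Λ where
  toFun f :=
    { toFun := fun v => ((f (1 ⊗ₜ v) : ℚ) : ℂ)
      map_add' := fun v w => by simp [TensorProduct.tmul_add]
      map_smul' := fun m v => by
        rw [TensorProduct.tmul_smul, map_zsmul]
        simp }
  map_add' f g := by ext v; simp
  map_smul' q f := by ext v; simp [Algebra.smul_def]

/-- The natural map `H^k(A, ℚ) → H^k(A, ℂ)`, sending `f₁ ∧ ⋯ ∧ f_k` to `f₁ ∧ ⋯ ∧ f_k`. -/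
def cohQToC (k : ℕ) : torusCohQ Λ k →ₗ[ℚ] torusCohC Λ k :=
  exteriorPower.alternatingMapLinearEquiv
    { ((exteriorPower.ιMulti ℂ k (M := torusCohC1 Λ)).toMultilinearMap.restrictScalars
        ℚ).compLinearMap (fun _ => cohQ1ToC1 Λ) with
      map_eq_zero_of_eq' := fun v _ _ hv hij =>
        (exteriorPower.ιMulti ℂ k (M := torusCohC1 Λ)).map_eq_zero_of_eq
          (fun l => cohQ1ToC1 Λ (v l)) (congrArg (cohQ1ToC1 Λ) hv) hij }

/-- `H^{1,0}(A) ⊂ H¹(A, ℂ)`: the restrictions to `Λ` of the `ℂ`-linear functionals on `V = T₀A`. -/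
def hodge10 : Submodule ℂ (torusCohC1 Λ) where
  carrier := {f | ∃ g : V →ₗ[ℂ] ℂ, ∀ v : Λ, f v = g v}
  add_mem' := by
    rintro _ _ ⟨g, hg⟩ ⟨g', hg'⟩
    exact ⟨g + g', fun v => by simp [hg, hg']⟩
  zero_mem' := ⟨0, fun v => by simp⟩
  smul_mem' := by
    rintro c _ ⟨g, hg⟩
    exact ⟨c • g, fun v => by simp [hg]⟩

/-- `H^{0,1}(A) ⊂ H¹(A, ℂ)`: the restrictions to `Λ` of the conjugate-linear functionals on `V`. -/
def hodge01 : Submodule ℂ (torusCohC1 Λ) where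
  carrier := {f | ∃ g : V →ₛₗ[starRingEnd ℂ] ℂ, ∀ v : Λ, f v = g v}
  add_mem' := by
    rintro _ _ ⟨g, hg⟩ ⟨g', hg'⟩
    exact ⟨g + g', fun v => by simp [hg, hg']⟩
  zero_mem' := ⟨0, fun v => by simp⟩
  smul_mem' := by
    rintro c _ ⟨g, hg⟩
    exact ⟨c • g, fun v => by simp [hg]⟩

/-- `H^{p,q}(A) ⊂ H^k(A, ℂ)` for `p + q = k`: the span of the products `a₁ ∧ ⋯ ∧ a_p ∧ b₁ ∧ ⋯ ∧ b_q`
with all `a_i` in `H^{1,0}(A)` and all `b_j` in `H^{0,1}(A)`. -/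
def hodgePiece (p q : ℕ) {k : ℕ} (_hk : p + q = k) : Submodule ℂ (torusCohC Λ k) :=
  Submodule.span ℂ {ω | ∃ v : Fin k → torusCohC1 Λ,
    (∀ i : Fin k, (i : ℕ) < p → v i ∈ hodge10 Λ) ∧
    (∀ i : Fin k, p ≤ (i : ℕ) → v i ∈ hodge01 Λ) ∧
    ω = exteriorPower.ιMulti ℂ k v}

/-! ### Weil classes and quaternion classes -/

variable {Λ}

/-- The action `⋀^k x^*` of `x ∈ End(A) ⊗ ℚ` on `H^k(A, ℚ) = ⋀^k H¹(A, ℚ)`, where `x^*` is the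
transpose of the action of `x` on `H₁(A, ℚ)`. -/
def cohAction (k : ℕ) (x : torusEndQ Λ) : Module.End ℚ (torusCohQ Λ k) :=
  exteriorPower.map k (rationalRep Λ x).dualMap

variable {F : Type*} [Ring F] [Algebra ℚ F]

/-- `W_x ⊂ H^{2n}(A, ℚ)` for `x` in a quadratic field `K ⊂ F`: the kernel of `f(x)`, where
`f = (T - σ(x)^{2n}) (T - σ̄(x)^{2n}) = T² - Tr_{K/ℚ}(x^{2n}) T + N_{K/ℚ}(x^{2n})` and `σ`, `σ̄` are the
complex embeddings of `K`. Trace and norm are those of multiplication by `x^{2n}` on `K`. -/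
def weilKernel (ι : F →ₐ[ℚ] torusEndQ Λ) (n : ℕ) (K : Subalgebra ℚ F) (x : K) :
    Submodule ℚ (torusCohQ Λ (2 * n)) :=
  LinearMap.ker
    (cohAction (2 * n) (ι x) ^ 2
      - LinearMap.trace ℚ K (LinearMap.mulLeft ℚ (x ^ (2 * n))) • cohAction (2 * n) (ι x)
      + LinearMap.det (LinearMap.mulLeft ℚ (x ^ (2 * n))) • (1 : Module.End ℚ (torusCohQ Λ (2 * n))))

/-- The space of Weil classes `W_K = ⋂_{x ∈ K} W_x ⊂ H^{2n}(A, ℚ)`. -/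
def weilClasses (ι : F →ₐ[ℚ] torusEndQ Λ) (n : ℕ) (K : Subalgebra ℚ F) :
    Submodule ℚ (torusCohQ Λ (2 * n)) :=
  ⨅ x : K, weilKernel ι n K x

/-- The space of quaternion classes `W_F ⊂ H^{2n}(A, ℚ)` defined by means of `K ⊂ F`: the span of
the translates `x · W_K` for `x ∈ F`. -/
def quaternionClasses (ι : F →ₐ[ℚ] torusEndQ Λ) (n : ℕ) (K : Subalgebra ℚ F) :
    Submodule ℚ (torusCohQ Λ (2 * n)) :=
  ⨆ x : F, (weilClasses ι n K).map (cohAction (2 * n) (ι x))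

end Torus

end

/-!
Over `ℂ`, the transposed action of `F` on `H¹(A, ℂ)` is a right module over `M₂(ℂ)`. Choose
`σ(K)`-eigenvectors `u₁, …, u_{2n}`, a basis of the `σ`-eigenspace, with `n` of them in `H^{1,0}`
and `n` in `H^{0,1}`, and an element `b ∈ F` which exchanges the two eigenspaces of `K`. Then
`W_K ⊗ ℂ` is spanned by the two wedges `⋀ᵢ uᵢ` and `⋀ᵢ uᵢb`, and `W_F ⊗ ℂ` by the wedges `⋀ᵢ wᵢ`,
where `w` runs over the plane spanned by the tuples `u` and `ub`. Expanding `⋀ᵢ (s uᵢ + t uᵢb)` in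
powers of `s` and `t` gives `2n + 1` independent coefficients, hence the dimension; since `F`
preserves Hodge types, every wedge is of type `(n, n)`. The plane is the `F`-submodule generated
by `u`, which contains the eigentuples of every other quadratic subfield as well, so `W_F` does
not depend on `K`.
-/

noncomputable section

/-! ### Base change of vector spaces -/

section BaseChange

variable {k L M N : Type*} [Field k] [Field L] [Algebra k L] [AddCommGroup M] [Module k M]
  [AddCommGroup N] [Module k N] [Module L N] [IsScalarTower k L N] {f : M →ₗ[k] N}

theorem isBaseChange_of_map_basis {I : Type*} (b : Module.Basis I k M) (b' : Module.Basis I L N)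
    (h : ∀ i, f (b i) = b' i) : IsBaseChange L f := by
  let e : L ⊗[k] M ≃ₗ[L] N := (b.baseChange L).equiv b' (Equiv.refl I)
  have he : (e.toLinearMap.restrictScalars k) ∘ₗ TensorProduct.mk k L M 1 = f := b.ext fun i => by
    have := (b.baseChange L).equiv_apply (b' := b') i (Equiv.refl I)
    rw [Module.Basis.baseChange_apply] at this
    simpa [h] using this
  exact IsBaseChange.of_equiv e (LinearMap.congr_fun he)

theorem span_image_span (s : Set M) :
    Submodule.span L (f '' Submodule.span k s) = Submodule.span L (f '' s) := by
  rw [← Submodule.map_coe, Submodule.map_span, Submodule.span_span_of_tower]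

theorem span_image_iSup {I : Sort*} (W : I → Submodule k M) :
    Submodule.span L (f '' ↑(⨆ i, W i)) = ⨆ i, Submodule.span L (f '' W i) := by
  rw [Submodule.iSup_eq_span, span_image_span, Set.image_iUnion, Submodule.span_iUnion]

theorem linearIndependent_comp_of_isBaseChange (hf : IsBaseChange L f) {I : Type*} {v : I → M}
    (hv : LinearIndependent k v) : LinearIndependent L (f ∘ v) := by
  have h := (Module.Flat.linearIndependent_one_tmul (S := L) hv).map' hf.equiv.toLinearMap
    hf.equiv.ker
  simpa only [Function.comp_def, LinearEquiv.coe_coe, hf.equiv_tmul, one_smul] using h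

theorem finrank_span_image_of_isBaseChange (hf : IsBaseChange L f) (W : Submodule k M) :
    Module.finrank L (Submodule.span L (f '' W)) = Module.finrank k W := by
  let b := Module.Basis.ofVectorSpace k W
  have hb : LinearIndependent k (W.subtype ∘ b) := b.linearIndependent.map' _ W.ker_subtype
  have hW : Submodule.span L (Set.range (f ∘ W.subtype ∘ b)) = Submodule.span L (f '' W) := by
    rw [Set.range_comp, ← span_image_span (k := k), Set.range_comp, ← Submodule.map_span,
      b.span_eq, Submodule.map_subtype_top]
  rw [← hW, Module.finrank_eq_nat_card_basis
    (Module.Basis.span (linearIndependent_comp_of_isBaseChange hf hb)),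
    Module.finrank_eq_nat_card_basis b]

theorem le_of_span_image_le_of_isBaseChange (hf : IsBaseChange L f) {W W' : Submodule k M}
    (h : Submodule.span L (f '' W) ≤ Submodule.span L (f '' W')) : W ≤ W' := by
  intro x hx
  by_contra hx'
  obtain ⟨φ, hφ, hW'⟩ := Submodule.exists_le_ker_of_notMem hx'
  let Φ : N →ₗ[L] L := hf.lift ((Algebra.linearMap k L) ∘ₗ φ)
  have hΦ : Submodule.span L (f '' W') ≤ LinearMap.ker Φ := by
    rw [Submodule.span_le]
    rintro _ ⟨y, hy, rfl⟩
    simp [Φ, hf.lift_eq, LinearMap.mem_ker.1 (hW' hy)]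
  have hx : Φ (f x) = 0 := hΦ (h (Submodule.subset_span ⟨x, hx, rfl⟩))
  exact hφ (by simpa [Φ, hf.lift_eq] using hx)

theorem span_range_of_isBaseChange (hf : IsBaseChange L f) :
    Submodule.span L (Set.range f) = ⊤ := by
  rw [eq_top_iff]
  intro x _
  induction x using hf.inductionOn with
  | zero => exact zero_mem _
  | tmul m => exact Submodule.subset_span ⟨m, rfl⟩
  | smul s n hn => exact Submodule.smul_mem _ _ (hn trivial)
  | add a b ha hb => exact add_mem (ha trivial) (hb trivial)

theorem span_image_ker_of_isBaseChange (hf : IsBaseChange L f) {A : Module.End k M}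
    {A' : Module.End L N} (h : ∀ x, A' (f x) = f (A x)) :
    Submodule.span L (f '' LinearMap.ker A) = LinearMap.ker A' := by
  let g : LinearMap.ker A →ₗ[k] LinearMap.ker A' :=
    { toFun := fun x => ⟨f x, by rw [LinearMap.mem_ker, h, x.2, map_zero]⟩
      map_add' := fun x y => Subtype.ext (map_add f _ _)
      map_smul' := fun c x => Subtype.ext (map_smul f _ _) }
  have hg : IsBaseChange L g :=
    IsBaseChange.of_left_exact L g f f rfl (LinearMap.ext fun x => (h x).symm) hf hf
      A.exact_subtype_ker_map (Submodule.injective_subtype _)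
      A'.exact_subtype_ker_map (Submodule.injective_subtype _)
  have hfg : f '' LinearMap.ker A = (LinearMap.ker A').subtype '' Set.range g := by
    rw [← Set.range_comp, Set.image_eq_range]
    rfl
  rw [hfg, ← Submodule.map_span, span_range_of_isBaseChange hg, Submodule.map_subtype_top]

end BaseChange

/-! ### Decomposable vectors in an exterior power -/

section Pencil

variable {k L E E' : Type*} [Field L] [AddCommGroup E] [Module L E] [AddCommGroup E'] [Module L E']

theorem mem_of_infinite_sum_pow_smul_mem {S : Submodule L E} {T : Set L} (hT : T.Infinite)
    {N : ℕ} {y : ℕ → E} (h : ∀ t ∈ T, ∑ i ∈ Finset.range N, t ^ i • y i ∈ S) {i : ℕ} (hi : i < N) :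
    y i ∈ S := by
  by_contra hy
  obtain ⟨φ, hφ, hS⟩ := Submodule.exists_le_ker_of_notMem hy
  let p : Polynomial L := ∑ i ∈ Finset.range N, Polynomial.monomial i (φ (y i))
  have hp : p = 0 := by
    refine Polynomial.eq_zero_of_infinite_isRoot p (hT.mono fun t ht => ?_)
    have hφt : φ (∑ i ∈ Finset.range N, t ^ i • y i) = 0 := hS (h t ht)
    simpa [p, Polynomial.eval_finsetSum, mul_comm] using hφt
  have hpi : p.coeff i = φ (y i) := by simp [p, Polynomial.coeff_monomial, hi]
  exact hφ (by rw [← hpi, hp, Polynomial.coeff_zero])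

theorem exists_linearMap_apply_eq {I : Type*} {v : I → E} (hv : LinearIndependent L v)
    (y : I → E') : ∃ π : E →ₗ[L] E', ∀ i, π (v i) = y i := by
  obtain ⟨π, hπ⟩ := LinearMap.exists_extend ((Module.Basis.span hv).constr L y)
  refine ⟨π, fun i => ?_⟩
  have h := (Module.Basis.span hv).constr_basis L y i
  rwa [← hπ, LinearMap.comp_apply, Submodule.subtype_apply, Module.Basis.span_apply] at h

variable {I : Type*} [Fintype I] [DecidableEq I]

/-- The coefficient of `a ^ i * b ^ (card I - i)` in `f (a • v + b • w)`, for `f` multilinear. -/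
def pencilCoeff (f : (I → E) → E') (v w : I → E) (i : ℕ) : E' :=
  ∑ s ∈ Finset.powersetCard i Finset.univ, f (s.piecewise v w)

theorem map_smul_add_smul (f : MultilinearMap L (fun _ : I => E) E') (v w : I → E) (a b : L) :
    f (a • v + b • w) = ∑ i ∈ Finset.range (Fintype.card I + 1),
      (a ^ i * b ^ (Fintype.card I - i)) • pencilCoeff f v w i := by
  have hs (s : Finset I) : f (s.piecewise (a • v) (b • w)) =
      (a ^ s.card * b ^ (Fintype.card I - s.card)) • f (s.piecewise v w) := by
    have : s.piecewise (a • v) (b • w) =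
        fun i => s.piecewise (fun _ => a) (fun _ => b) i • s.piecewise v w i := by
      ext i
      by_cases hi : i ∈ s <;> simp [hi]
    rw [this, f.map_smul_univ, Finset.prod_piecewise]
    simp [Finset.card_sdiff]
  rw [f.map_add_univ, ← Finset.powerset_univ, Finset.sum_powerset, Finset.card_univ]
  refine Finset.sum_congr rfl fun i _ => ?_
  rw [pencilCoeff, Finset.smul_sum]
  refine Finset.sum_congr rfl fun s hsi => ?_
  rw [hs, (Finset.mem_powersetCard.1 hsi).2]

theorem map_mem_of_mem_span {J : Type*} [Finite J] [Field k] [Infinite k] [Algebra k L]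
    [Module k E] [IsScalarTower k L E] (f : MultilinearMap L (fun _ : J => E) E')
    {S : Submodule L E'} {M : Submodule k (J → E)} (hM : ∀ m ∈ M, f m ∈ S) {v : J → E}
    (hv : v ∈ Submodule.span L (M : Set (J → E))) : f v ∈ S := by
  classical
  have := Fintype.ofFinite J
  suffices ∀ w, (∀ m ∈ M, f (w + m) ∈ S) → ∀ m ∈ M, f (w + v + m) ∈ S by
    simpa using this 0 (by simpa using hM) 0 M.zero_mem
  induction hv using Submodule.closure_induction with
  | zero => simp
  | add x y _ _ hx hy =>
    intro w hw m hm
    rw [← add_assoc]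
    exact hy (w + x) (hx w hw) m hm
  | smul_mem c x hx =>
    intro w hw m hm
    have hexp (t : L) : f (w + t • x + m) = ∑ i ∈ Finset.range (Fintype.card J + 1),
        t ^ i • pencilCoeff f x (w + m) i := by
      simpa [add_comm, add_left_comm, add_assoc] using map_smul_add_smul f x (w + m) t 1
    have hy : ∀ i < Fintype.card J + 1, pencilCoeff f x (w + m) i ∈ S := fun i =>
      mem_of_infinite_sum_pow_smul_mem (Set.infinite_range_of_injective
        (algebraMap k L).injective) <| by
        rintro _ ⟨t, rfl⟩
        rw [← hexp, algebraMap_smul, add_assoc]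
        exact hw _ (add_mem (M.smul_mem t hx) hm)
    rw [hexp]
    exact sum_mem fun i hi => S.smul_mem _ (hy i (Finset.mem_range.1 hi))

variable {N : ℕ}

/-- The span of the decomposable vectors `u₁ ∧ ⋯ ∧ u_N`, for `u` in a subspace `U` of `E ^ N`. -/
def decomposableSpan (U : Submodule L (Fin N → E)) : Submodule L (⋀[L]^N E) :=
  Submodule.span L (exteriorPower.ιMulti L N '' U)

theorem span_ιMulti_image_eq_decomposableSpan [Field k] [Infinite k] [Algebra k L] [Module k E]
    [IsScalarTower k L E] (M : Submodule k (Fin N → E)) :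
    Submodule.span L (exteriorPower.ιMulti L N '' M) =
      decomposableSpan (Submodule.span L (M : Set (Fin N → E))) := by
  refine le_antisymm (Submodule.span_mono (Set.image_mono Submodule.subset_span)) ?_
  rw [decomposableSpan, Submodule.span_le]
  rintro _ ⟨v, hv, rfl⟩
  have hM : ∀ m ∈ M, (exteriorPower.ιMulti L N).toMultilinearMap m ∈
      Submodule.span L (exteriorPower.ιMulti L N '' M) :=
    fun m hm => Submodule.subset_span ⟨m, hm, rfl⟩
  exact map_mem_of_mem_span _ hM hv

theorem decomposableSpan_span_pair [Infinite L] (v w : Fin N → E) :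
    decomposableSpan (Submodule.span L {v, w}) = Submodule.span L (Set.range fun i : Fin (N + 1) =>
      pencilCoeff (exteriorPower.ιMulti L N) v w i) := by
  have hexp (a b : L) : exteriorPower.ιMulti L N (a • v + b • w) =
      ∑ i ∈ Finset.range (N + 1), (a ^ i * b ^ (N - i)) •
        pencilCoeff (exteriorPower.ιMulti L N) v w i := by
    have h := map_smul_add_smul (exteriorPower.ιMulti L N).toMultilinearMap v w a b
    rwa [Fintype.card_fin] at h
  apply le_antisymm
  · rw [decomposableSpan, Submodule.span_le]
    rintro _ ⟨u, hu, rfl⟩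
    obtain ⟨a, b, rfl⟩ := Submodule.mem_span_pair.1 hu
    rw [SetLike.mem_coe, hexp]
    exact sum_mem fun i hi =>
      Submodule.smul_mem _ _ (Submodule.subset_span ⟨⟨i, Finset.mem_range.1 hi⟩, rfl⟩)
  · rw [Submodule.span_le]
    rintro _ ⟨i, rfl⟩
    refine mem_of_infinite_sum_pow_smul_mem Set.infinite_univ (fun t _ => ?_) i.2
    have h1 := hexp t 1
    simp only [one_pow, mul_one, one_smul] at h1
    rw [← h1]
    exact Submodule.subset_span ⟨_, Submodule.mem_span_pair.2 ⟨t, 1, by rw [one_smul]⟩, rfl⟩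

/-- Any linear extension of `eᵢ ↦ X • δᵢ`, `fᵢ ↦ δᵢ` followed by the determinant carries the
coefficients of the pencil to the binomial multiples of the powers of `X`. -/
theorem linearIndependent_pencilCoeff [CharZero L] {v w : Fin N → E}
    (h : LinearIndependent L (Sum.elim v w)) :
    LinearIndependent L fun i : Fin (N + 1) =>
      pencilCoeff (exteriorPower.ιMulti L N) v w i := by
  obtain ⟨π, hπ⟩ := exists_linearMap_apply_eq h
    (Sum.elim (fun i => Pi.single i Polynomial.X) fun i => Pi.single i (1 : Polynomial L))
  let δ : ⋀[L]^N E →ₗ[L] Polynomial L := exteriorPower.alternatingMapLinearEquiv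
    { (Matrix.detRowAlternating.toMultilinearMap.restrictScalars L).compLinearMap fun _ => π with
      map_eq_zero_of_eq' := fun u _ _ hu hij =>
        Matrix.detRowAlternating.map_eq_zero_of_eq (fun l => π (u l)) (congrArg π hu) hij }
  have hδ (s : Finset (Fin N)) : δ (exteriorPower.ιMulti L N (s.piecewise v w)) =
      Polynomial.X ^ s.card := by
    have hπs : (fun i => π (s.piecewise v w i)) =
        Matrix.diagonal (s.piecewise (fun _ => Polynomial.X) fun _ => 1) := by
      ext i j : 2
      by_cases hi : i ∈ s
      · simpa [hi, Matrix.diagonal_apply, Pi.single_apply, eq_comm] using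
          congrFun (hπ (Sum.inl i)) j
      · simpa [hi, Matrix.diagonal_apply, Pi.single_apply, eq_comm] using
          congrFun (hπ (Sum.inr i)) j
    rw [exteriorPower.alternatingMapLinearEquiv_apply_ιMulti]
    change Matrix.det (fun i => π (s.piecewise v w i)) = _
    rw [hπs, Matrix.det_diagonal, Finset.prod_piecewise]
    simp
  have hcoeff (i : Fin (N + 1)) :
      δ (pencilCoeff (exteriorPower.ιMulti L N) v w i) =
        (N.choose i : L) • Polynomial.X ^ (i : ℕ) := by
    rw [pencilCoeff, map_sum, Finset.sum_congr rfl fun s hs =>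
      (hδ s).trans (congrArg _ (Finset.mem_powersetCard.1 hs).2)]
    simp [Nat.cast_smul_eq_nsmul]
  have hX : LinearIndependent L fun i : Fin (N + 1) => (Polynomial.X : Polynomial L) ^ (i : ℕ) := by
    simpa [Function.comp_def, Polynomial.X_pow_eq_monomial] using
      (Polynomial.basisMonomials L).linearIndependent.comp _ Fin.val_injective
  have hchoose (i : Fin (N + 1)) : (N.choose i : L) ≠ 0 :=
    Nat.cast_ne_zero.2 (Nat.choose_pos (Nat.lt_succ_iff.1 i.2)).ne'
  refine LinearIndependent.of_comp δ ?_
  rw [Function.comp_def, funext hcoeff]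
  exact hX.units_smul fun i => Units.mk0 _ (hchoose i)

theorem finrank_decomposableSpan_span_pair [CharZero L] {v w : Fin N → E}
    (h : LinearIndependent L (Sum.elim v w)) :
    Module.finrank L (decomposableSpan (Submodule.span L {v, w})) = N + 1 := by
  rw [decomposableSpan_span_pair, finrank_span_eq_card (linearIndependent_pencilCoeff h),
    Fintype.card_fin]

end Pencil

/-! ### Eigenvectors of exterior powers -/

section Eigen

variable {L E : Type*} [Field L] [AddCommGroup E] [Module L E] {N : ℕ}

theorem ker_le_span_of_apply_basis_eq_smul {I : Type*} (b : Module.Basis I L E) {c : I → L}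
    {A : Module.End L E} (h : ∀ i, A (b i) = c i • b i) :
    LinearMap.ker A ≤ Submodule.span L (b '' {i | c i = 0}) := by
  intro x hx
  refine b.mem_span_image.2 fun i hi => ?_
  have hcoord : b.coord i ∘ₗ A = c i • b.coord i := b.ext fun j => by
    by_cases hij : j = i <;> simp [h, hij]
  have hi0 : c i * b.repr x i = 0 := by
    simpa [LinearMap.mem_ker.1 hx] using (LinearMap.congr_fun hcoord x).symm
  exact (mul_eq_zero.1 hi0).resolve_right (Finsupp.mem_support_iff.1 hi)

theorem exteriorPower_map_ιMulti_of_apply_eq_smul {g : Module.End L E} {c : Fin N → L}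
    {v : Fin N → E} (h : ∀ i, g (v i) = c i • v i) :
    exteriorPower.map N g (exteriorPower.ιMulti L N v) =
      (∏ i, c i) • exteriorPower.ιMulti L N v := by
  rw [exteriorPower.map_apply_ιMulti, ← AlternatingMap.map_smul_univ]
  exact congrArg _ (funext h)

theorem ιMulti_comp_mem_span_singleton (v : Fin N → E) {σ : Fin N → Fin N}
    (hσ : Function.Injective σ) :
    exteriorPower.ιMulti L N (v ∘ σ) ∈ Submodule.span L {exteriorPower.ιMulti L N v} := by
  have h := (exteriorPower.ιMulti L N (M := E)).map_perm v
    (Equiv.ofBijective σ (Finite.injective_iff_bijective.1 hσ))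
  rw [Equiv.coe_ofBijective] at h
  rw [h, Units.smul_def, ← Int.cast_smul_eq_zsmul L]
  exact Submodule.smul_mem _ _ (Submodule.mem_span_singleton_self _)

theorem eq_of_prod_eq_pow_card {I : Type*} [Fintype I] {μ ν : L} (hμ : μ ≠ 0)
    (hμν : ∀ m, 1 ≤ m → m ≤ Fintype.card I → μ ^ m ≠ ν ^ m) {c : I → L}
    (hc : ∀ i, c i = μ ∨ c i = ν) (h : ∏ i, c i = μ ^ Fintype.card I) (i : I) : c i = μ := by
  classical
  by_contra hi
  let S := Finset.univ.filter fun j => c j = μ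
  have hprod : ∏ i, c i = μ ^ S.card * ν ^ Sᶜ.card := by
    rw [← Finset.prod_mul_prod_compl S]
    congr 1 <;> refine Finset.prod_eq_pow_card fun j hj => ?_
    · simpa [S] using hj
    · exact (hc j).resolve_left (by simpa [S] using hj)
  rw [hprod, ← S.card_add_card_compl, pow_add] at h
  exact hμν _ (Finset.card_pos.2 ⟨i, by simpa [S] using hi⟩) (Finset.card_le_univ _)
    (mul_left_cancel₀ (pow_ne_zero _ hμ) h).symm

theorem exteriorPower_map_basis_of_apply_basis_eq_smul {I : Type*} [LinearOrder I]
    (b : Module.Basis I L E) {g : Module.End L E} {c : I → L} (h : ∀ i, g (b i) = c i • b i)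
    (s : Set.powersetCard I N) :
    exteriorPower.map N g (b.exteriorPower N s) =
      (∏ i, c (Set.powersetCard.ofFinEmbEquiv.symm s i)) • b.exteriorPower N s := by
  rw [exteriorPower.basis_apply, exteriorPower.ιMulti_family]
  exact exteriorPower_map_ιMulti_of_apply_eq_smul fun i => h _

theorem mul_sub_algebraMap_apply_of_apply_eq_smul {A : Module.End L E} {a : L} {x : E}
    (hx : A x = a • x) (μ ν : L) :
    ((A - algebraMap L _ μ) * (A - algebraMap L _ ν)) x = ((a - μ) * (a - ν)) • x := by
  simp only [Module.End.mul_apply, LinearMap.sub_apply, Module.algebraMap_end_apply, hx, map_sub,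
    map_smul]
  module

theorem ker_exteriorPower_map_le_span {I : Type*} (b : Module.Basis I L E) {g : Module.End L E}
    {c : I → L} (h : ∀ i, g (b i) = c i • b i) (μ ν : L) :
    LinearMap.ker ((exteriorPower.map N g - algebraMap L _ μ) *
        (exteriorPower.map N g - algebraMap L _ ν)) ≤
      Submodule.span L ((fun v : Fin N → I => exteriorPower.ιMulti L N (b ∘ v)) ''
        {v | v.Injective ∧ (∏ i, c (v i) = μ ∨ ∏ i, c (v i) = ν)}) := by
  classical
  let : LinearOrder I := linearOrderOfSTO WellOrderingRel
  refine (ker_le_span_of_apply_basis_eq_smul (b.exteriorPower N) fun s =>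
    mul_sub_algebraMap_apply_of_apply_eq_smul
      (exteriorPower_map_basis_of_apply_basis_eq_smul b h s) _ _).trans (Submodule.span_mono ?_)
  rintro _ ⟨s, hs, rfl⟩
  refine ⟨Set.powersetCard.ofFinEmbEquiv.symm s, ⟨RelEmbedding.injective _, ?_⟩, ?_⟩
  · simpa only [mul_eq_zero, sub_eq_zero, Set.mem_ofPred_eq] using hs
  · rw [exteriorPower.basis_apply, exteriorPower.ιMulti_family]

theorem ιMulti_comp_mem_span_singleton_of_prod_eq_pow {I : Type*} (b : I → E) {μ ν : L}
    (hμ : μ ≠ 0) (hμν : ∀ m, 1 ≤ m → m ≤ N → μ ^ m ≠ ν ^ m) {c : I → L}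
    (hc : ∀ i, c i = μ ∨ c i = ν) {j : Fin N → I} (hj : ∀ i, c i = μ → i ∈ Set.range j)
    {v : Fin N → I} (hv : Function.Injective v) (h : ∏ i, c (v i) = μ ^ N) :
    exteriorPower.ιMulti L N (b ∘ v) ∈ Submodule.span L {exteriorPower.ιMulti L N (b ∘ j)} := by
  have hcv := eq_of_prod_eq_pow_card hμ (by simpa using hμν) (fun i => hc (v i)) (by simpa using h)
  choose σ hσ using fun i => hj (v i) (hcv i)
  have hjσ : v = j ∘ σ := (funext hσ).symm
  rw [hjσ, ← Function.comp_assoc]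
  exact ιMulti_comp_mem_span_singleton _ (.of_comp (hjσ ▸ hv))

theorem ker_exteriorPower_map_eq_span_pair {g : Module.End L E}
    (b : Module.Basis (Fin N ⊕ Fin N) L E) {μ ν : L} (hμ : μ ≠ 0) (hν : ν ≠ 0)
    (hμν : ∀ m, 1 ≤ m → m ≤ N → μ ^ m ≠ ν ^ m) (hl : ∀ i, g (b (.inl i)) = μ • b (.inl i))
    (hr : ∀ i, g (b (.inr i)) = ν • b (.inr i)) :
    LinearMap.ker ((exteriorPower.map N g - algebraMap L _ (μ ^ N)) *
        (exteriorPower.map N g - algebraMap L _ (ν ^ N))) =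
      Submodule.span L {exteriorPower.ιMulti L N (b ∘ Sum.inl),
        exteriorPower.ιMulti L N (b ∘ Sum.inr)} := by
  let c : Fin N ⊕ Fin N → L := Sum.elim (fun _ => μ) fun _ => ν
  have hc : ∀ i, c i = μ ∨ c i = ν := Sum.rec (fun _ => .inl rfl) fun _ => .inr rfl
  have hne (i : Fin N) : μ ≠ ν := by simpa using hμν 1 le_rfl i.pos
  apply le_antisymm
  · refine (ker_exteriorPower_map_le_span b (c := c) (Sum.rec hl hr) _ _).trans
      (Submodule.span_le.2 ?_)
    rintro _ ⟨v, ⟨hv, h | h⟩, rfl⟩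
    · refine Submodule.span_mono (by simp)
        (ιMulti_comp_mem_span_singleton_of_prod_eq_pow b hμ hμν hc (j := Sum.inl) ?_ hv h)
      exact Sum.rec (fun i _ => ⟨i, rfl⟩) fun i hi => absurd hi.symm (hne i)
    · refine Submodule.span_mono (by simp)
        (ιMulti_comp_mem_span_singleton_of_prod_eq_pow b hν (fun m h1 hN => (hμν m h1 hN).symm)
          (fun i => (hc i).symm) (j := Sum.inr) ?_ hv h)
      exact Sum.rec (fun i hi => absurd hi (hne i)) fun i _ => ⟨i, rfl⟩
  · rw [Submodule.span_le, Set.pair_subset_iff]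
    have hl' := exteriorPower_map_ιMulti_of_apply_eq_smul (v := b ∘ Sum.inl) hl
    have hr' := exteriorPower_map_ιMulti_of_apply_eq_smul (v := b ∘ Sum.inr) hr
    exact ⟨(mul_sub_algebraMap_apply_of_apply_eq_smul hl' _ _).trans (by simp),
      (mul_sub_algebraMap_apply_of_apply_eq_smul hr' _ _).trans (by simp)⟩

theorem exists_pow_add_ne_pow_add {k : Type*} [Field k] [Infinite k] [Algebra k L] {s s' : L}
    (h : s ≠ s') (N : ℕ) : ∃ t : k, algebraMap k L t + s ≠ 0 ∧ algebraMap k L t + s' ≠ 0 ∧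
      ∀ m, 1 ≤ m → m ≤ N → (algebraMap k L t + s) ^ m ≠ (algebraMap k L t + s') ^ m := by
  open Polynomial in
  let p : L[X] := (X + C s) * (X + C s') * ∏ m ∈ Finset.Icc 1 N, ((X + C s) ^ m - (X + C s') ^ m)
  have hp : p ≠ 0 := by
    refine mul_ne_zero (mul_ne_zero (X_add_C_ne_zero s) (X_add_C_ne_zero s'))
      (Finset.prod_ne_zero_iff.2 fun m hm hm0 => ?_)
    have hm' : m ≠ 0 := Nat.one_le_iff_ne_zero.1 (Finset.mem_Icc.1 hm).1
    have hev := congrArg (eval (-s')) hm0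
    simp only [eval_sub, eval_pow, eval_add, eval_X, eval_C, neg_add_cancel, zero_pow hm', sub_zero,
      eval_zero] at hev
    exact h (neg_add_eq_zero.1 (pow_eq_zero_iff hm' |>.1 hev)).symm
  obtain ⟨_, ⟨t, rfl⟩, ht⟩ : ∃ x ∈ Set.range (algebraMap k L), ¬ p.IsRoot x := by
    by_contra! hroot
    exact hp (Polynomial.eq_zero_of_infinite_isRoot p
      ((Set.infinite_range_of_injective (algebraMap k L).injective).mono hroot))
  simp only [p, Polynomial.IsRoot.def, Polynomial.eval_mul, Polynomial.eval_add,
    Polynomial.eval_sub, Polynomial.eval_X, Polynomial.eval_C, Polynomial.eval_prod,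
    Polynomial.eval_pow, mul_eq_zero, not_or, Finset.prod_eq_zero_iff, not_exists, not_and] at ht
  exact ⟨t, ht.1.1, ht.1.2, fun m h1 hN => sub_ne_zero.1 (ht.2 m (Finset.mem_Icc.2 ⟨h1, hN⟩))⟩

end Eigen

/-! ### Quadratic subfields of quaternion algebras -/

theorem eq_zero_or_eq_zero_of_forall_mul_mul_eq_zero {R : Type*} [Ring R] [IsSimpleRing R] {a b : R}
    (h : ∀ x, a * x * b = 0) : a = 0 ∨ b = 0 := by
  let I : TwoSidedIdeal R := .mk' {y | ∀ x, a * x * y = 0} (fun x => mul_zero _)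
    (fun hy hz x => by rw [mul_add, hy x, hz x, add_zero])
    (fun hy x => by rw [mul_neg, hy x, neg_zero])
    (fun {y z} hz x => by rw [← mul_assoc, mul_assoc a, hz])
    (fun {y z} hy x => by rw [← mul_assoc, hy, zero_mul])
  have hI (y : R) : y ∈ I ↔ ∀ x, a * x * y = 0 := by simp [I, TwoSidedIdeal.mem_mk']
  by_contra! hab
  have h1 := (hI 1).1 (IsSimpleRing.one_mem_of_ne_zero_mem I hab.2 ((hI b).2 h)) 1
  exact hab.1 (by simpa using h1)

theorem exists_ne_zero_mul_eq_neg_mul {k R : Type*} [Field k] [Ring R] [Algebra k R]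
    [Algebra.IsCentral k R] {a : R} (ha : a ∉ (⊥ : Subalgebra k R))
    (ha2 : a * a ∈ (⊥ : Subalgebra k R)) : ∃ b : R, b ≠ 0 ∧ b * a = -(a * b) := by
  obtain ⟨y, hy⟩ : ∃ y : R, y * a ≠ a * y := by
    by_contra! h
    exact ha (Algebra.IsCentral.out (Subalgebra.mem_center_iff.2 h))
  refine ⟨y * a - a * y, sub_ne_zero.2 hy, ?_⟩
  have hcomm : y * (a * a) = a * a * y :=
    Subalgebra.mem_center_iff.1 (bot_le (a := Subalgebra.center k R) ha2) y
  rw [sub_mul, mul_sub, mul_assoc, hcomm]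
  noncomm_ring

section Quaternion

variable {F : Type*} [Ring F] [Algebra ℚ F] {K : Subalgebra ℚ F} {a b : F}

theorem exists_eq_smul_one_add_smul (hK : Subalgebra.toSubmodule K = Submodule.span ℚ {1, a})
    (y : K) : ∃ p q : ℚ, y = p • (1 : F) + q • a :=
  (Submodule.mem_span_pair.1 (hK.le y.2)).imp fun _ => Exists.imp fun _ => Eq.symm

theorem mul_self_mem_center_of_mul_eq_neg_mul
    (hK : Subalgebra.toSubmodule K = Submodule.span ℚ {1, a})
    (hF : ∀ x : F, ∃ y z : K, x = y + b * z) (hba : b * a = -(a * b)) :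
    b * b ∈ Subalgebra.center ℚ F := by
  have hbba : a * (b * b) = b * b * a := by
    rw [mul_assoc, hba, mul_neg, ← mul_assoc b, hba, neg_mul, neg_neg, mul_assoc]
  have hcomm (y : K) : y * (b * b) = b * b * y := by
    obtain ⟨p, q, hy⟩ := exists_eq_smul_one_add_smul hK y
    simp only [hy, add_mul, mul_add, smul_mul_assoc, mul_smul_comm, hbba, one_mul, mul_one]
  refine Subalgebra.mem_center_iff.2 fun x => ?_
  obtain ⟨y, z, rfl⟩ := hF x
  rw [add_mul, mul_add, hcomm, mul_assoc b z, hcomm, ← mul_assoc b, ← mul_assoc (b * b),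
    ← mul_assoc b]

theorem isUnit_of_mul_eq_neg_mul [IsSimpleRing F] [Algebra.IsCentral ℚ F]
    (hK : Subalgebra.toSubmodule K = Submodule.span ℚ {1, a})
    (hF : ∀ x : F, ∃ y z : K, x = y + b * z) (hb : b ≠ 0) (hba : b * a = -(a * b)) : IsUnit b := by
  obtain ⟨c, hc⟩ := Algebra.mem_bot.1
    (Algebra.IsCentral.out (mul_self_mem_center_of_mul_eq_neg_mul hK hF hba))
  have hc0 : c ≠ 0 := by
    rintro rfl
    rw [map_zero] at hc
    have hbyb (y : K) : b * y * b = 0 := by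
      obtain ⟨p, q, hy⟩ := exists_eq_smul_one_add_smul hK y
      simp [hy, mul_add, add_mul, ← hc, hba, mul_assoc]
    refine hb (or_self_iff.1 (eq_zero_or_eq_zero_of_forall_mul_mul_eq_zero fun x => ?_))
    obtain ⟨y, z, rfl⟩ := hF x
    rw [mul_add, add_mul, hbyb, ← mul_assoc, ← hc, zero_mul, zero_mul, add_zero]
  refine isUnit_iff_exists.2 ⟨algebraMap ℚ F c⁻¹ * b, ?_, ?_⟩
  · rw [← mul_assoc, ← Algebra.commutes, mul_assoc, ← hc, ← map_mul, inv_mul_cancel₀ hc0, map_one]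
  · rw [mul_assoc, ← hc, ← map_mul, inv_mul_cancel₀ hc0, map_one]

/-- Generators `a` and `b` of a quaternion algebra adapted to a quadratic subfield `K`: `a` is a
square root of a rational number generating `K`, the unit `b` conjugates `a` into `-a`, and
`F = K + b K`. -/
structure IsQuaternionPair (K : Subalgebra ℚ F) (a b : F) : Prop where
  toSubmodule_eq : Subalgebra.toSubmodule K = Submodule.span ℚ {1, a}
  sq_mem : a * a ∈ (⊥ : Subalgebra ℚ F)
  mul_eq_neg_mul : b * a = -(a * b)
  isUnit : IsUnit b
  exists_eq : ∀ x : F, ∃ y z : K, x = y + b * z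

namespace IsQuadraticSubfield

theorem nontrivial (hK : IsQuadraticSubfield K) : Nontrivial F :=
  have := hK.isField.nontrivial
  Subtype.val_injective.nontrivial (α := K)

theorem exists_mem_notMem_bot (hK : IsQuadraticSubfield K) :
    ∃ a ∈ K, a ∉ (⊥ : Subalgebra ℚ F) := by
  have := hK.nontrivial
  by_contra! h
  have hdim := hK.finrank_eq
  have hbot : K = ⊥ := le_bot_iff.1 h
  rw [hbot, Subalgebra.finrank_bot] at hdim
  omega

theorem finiteDimensional (hK : IsQuadraticSubfield K) : FiniteDimensional ℚ K :=
  Module.finite_of_finrank_pos (by rw [hK.finrank_eq]; simp)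

theorem toSubmodule_eq_span_pair (hK : IsQuadraticSubfield K) (ha : a ∈ K)
    (ha' : a ∉ (⊥ : Subalgebra ℚ F)) :
    Subalgebra.toSubmodule K = Submodule.span ℚ {1, a} := by
  have := hK.nontrivial
  have hfin : FiniteDimensional ℚ (Subalgebra.toSubmodule K) := hK.finiteDimensional
  have hli : LinearIndependent ℚ ![1, a] := (LinearIndependent.pair_iff' one_ne_zero).2
    fun c hc => ha' (Algebra.mem_bot.2 ⟨c, by rw [Algebra.algebraMap_eq_smul_one, hc]⟩)
  rw [← Matrix.range_cons_cons_empty 1 a ![]]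
  refine (Submodule.eq_of_le_of_finrank_eq (Submodule.span_le.2 ?_) ?_).symm
  · rw [Matrix.range_cons_cons_empty, Set.pair_subset_iff]
    exact ⟨K.one_mem, ha⟩
  · rw [finrank_span_eq_card hli, Fintype.card_fin, Subalgebra.finrank_toSubmodule, hK.finrank_eq]

theorem exists_sq_mem_bot (hK : IsQuadraticSubfield K) :
    ∃ a ∈ K, a ∉ (⊥ : Subalgebra ℚ F) ∧ a * a ∈ (⊥ : Subalgebra ℚ F) := by
  obtain ⟨a, haK, ha⟩ := hK.exists_mem_notMem_bot
  have hsq : a * a ∈ Submodule.span ℚ {1, a} :=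
    hK.toSubmodule_eq_span_pair haK ha ▸ K.mul_mem haK haK
  obtain ⟨p, q, hpq⟩ := Submodule.mem_span_pair.1 hsq
  refine ⟨a - algebraMap ℚ F (q / 2), K.sub_mem haK (K.algebraMap_mem _), fun h => ha ?_, ?_⟩
  · simpa using add_mem h ((⊥ : Subalgebra ℚ F).algebraMap_mem (q / 2))
  · rw [Algebra.mem_bot]
    refine ⟨p + q ^ 2 / 4, ?_⟩
    simp only [Algebra.algebraMap_eq_smul_one, sub_mul, mul_sub, ← hpq, smul_mul_assoc,
      mul_smul_comm, one_mul, mul_one]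
    module

theorem isUnit_of_mem (hK : IsQuadraticSubfield K) (ha : a ∈ K) (ha0 : a ≠ 0) : IsUnit a := by
  let := hK.isField.toField
  have ha0' : (⟨a, ha⟩ : K) ≠ 0 := fun h => ha0 (congrArg Subtype.val h)
  exact ha0'.isUnit.map K.val

theorem exists_eq_add_mul (hK : IsQuadraticSubfield K) (hF : Module.finrank ℚ F = 4) (ha : a ∈ K)
    (ha0 : a ≠ 0) (hb : b ≠ 0) (hba : b * a = -(a * b)) (x : F) : ∃ y z : K, x = y + b * z := by
  have : FiniteDimensional ℚ F := Module.finite_of_finrank_pos (by rw [hF]; simp)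
  have : IsAddTorsionFree F := .of_module_rat _
  let f : K →ₗ[ℚ] F := LinearMap.mulLeft ℚ b ∘ₗ K.val.toLinearMap
  have hf : Function.Injective f := (injective_iff_map_eq_zero f).2 fun z (hz : b * (z : F) = 0) =>
    by_contra fun hz0 => hb <|
      (hK.isUnit_of_mem z.2 fun h => hz0 (Subtype.ext h)).mul_left_eq_zero.1 hz
  have hdisj : Disjoint (Subalgebra.toSubmodule K) (LinearMap.range f) := by
    rw [Submodule.disjoint_def]
    rintro _ hz ⟨z, rfl⟩
    have hcomm (y : K) : a * y = y * a :=
      congrArg Subtype.val (hK.isField.mul_comm ⟨a, ha⟩ y)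
    have hneg : a * (b * (z : F)) = -(a * (b * z)) := calc
      a * (b * (z : F)) = b * z * a := hcomm ⟨_, hz⟩
      _ = -(a * (b * z)) := by rw [mul_assoc, ← hcomm, ← mul_assoc, hba, neg_mul, mul_assoc]
    exact (hK.isUnit_of_mem ha ha0).mul_right_eq_zero.1 (self_eq_neg.1 hneg)
  have htop : Subalgebra.toSubmodule K ⊔ LinearMap.range f = ⊤ := by
    refine Submodule.eq_top_of_disjoint _ _ ?_ hdisj
    rw [LinearMap.finrank_range_of_inj hf, Subalgebra.finrank_toSubmodule, hK.finrank_eq, hF]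
  obtain ⟨y, hy, _, ⟨z, rfl⟩, hx⟩ := Submodule.mem_sup.1 (htop.ge (Submodule.mem_top (x := x)))
  exact ⟨⟨y, hy⟩, z, hx.symm⟩

theorem exists_isQuaternionPair [IsSimpleRing F] [Algebra.IsCentral ℚ F]
    (hF : Module.finrank ℚ F = 4) (hK : IsQuadraticSubfield K) : ∃ a b, IsQuaternionPair K a b := by
  obtain ⟨a, haK, ha, ha2⟩ := hK.exists_sq_mem_bot
  obtain ⟨b, hb, hba⟩ := exists_ne_zero_mul_eq_neg_mul ha ha2
  have hKa := hK.toSubmodule_eq_span_pair haK ha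
  have ha0 : a ≠ 0 := fun h => ha (h ▸ zero_mem _)
  have hKb := hK.exists_eq_add_mul hF haK ha0 hb hba
  exact ⟨a, b, hKa, ha2, hba, isUnit_of_mul_eq_neg_mul hKa hKb hb hba, hKb⟩

theorem card_algHom (hK : IsQuadraticSubfield K) : Nat.card (K →ₐ[ℚ] ℂ) = 2 := by
  let := hK.isField.toField
  have := hK.finiteDimensional
  rw [Nat.card_eq_fintype_card, AlgHom.card, hK.finrank_eq]

theorem exists_algHom_ne (hK : IsQuadraticSubfield K) : ∃ σ σ' : K →ₐ[ℚ] ℂ, σ ≠ σ' :=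
  have ⟨σ, σ', hσ, _⟩ := Nat.card_eq_two_iff.1 hK.card_algHom
  ⟨σ, σ', hσ⟩

variable {σ σ' : K →ₐ[ℚ] ℂ}

theorem univ_algHom [Fintype (K →ₐ[ℚ] ℂ)] [DecidableEq (K →ₐ[ℚ] ℂ)] (hK : IsQuadraticSubfield K)
    (hσ : σ ≠ σ') : Finset.univ = {σ, σ'} := by
  refine (Finset.eq_univ_of_card _ ?_).symm
  rw [Finset.card_pair hσ, ← Nat.card_eq_fintype_card, hK.card_algHom]

theorem trace_mulLeft_eq_add (hK : IsQuadraticSubfield K) (hσ : σ ≠ σ') (y : K) :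
    ((LinearMap.trace ℚ K (LinearMap.mulLeft ℚ y) : ℚ) : ℂ) = σ y + σ' y := by
  classical
  let := hK.isField.toField
  have := hK.finiteDimensional
  have h := trace_eq_sum_embeddings ℂ (K := ℚ) (x := y)
  rwa [hK.univ_algHom hσ, Finset.sum_pair hσ] at h

theorem det_mulLeft_eq_mul (hK : IsQuadraticSubfield K) (hσ : σ ≠ σ') (y : K) :
    ((LinearMap.det (LinearMap.mulLeft ℚ y) : ℚ) : ℂ) = σ y * σ' y := by
  classical
  let := hK.isField.toField
  have := hK.finiteDimensional
  have h := Algebra.norm_eq_prod_embeddings ℚ ℂ y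
  rwa [hK.univ_algHom hσ, Finset.prod_pair hσ] at h

end IsQuadraticSubfield

end Quaternion

/-! ### Right actions of quaternion algebras -/

section Anticommuting

variable {L E : Type*} [Field L] [CharZero L] [AddCommGroup E] [Module L E] [FiniteDimensional L E]
  {A B : Module.End L E} {s : L}

theorem two_mul_finrank_eigenspace_of_anticommute (hs : s ≠ 0) (hA : ∀ v, A (A v) = (s * s) • v)
    (hAB : ∀ v, A (B v) = -B (A v)) (hB : Function.Injective B) :
    2 * Module.finrank L (A.eigenspace s) = Module.finrank L E := by
  have hle (r : L) :
      Module.finrank L (A.eigenspace r) ≤ Module.finrank L (A.eigenspace (-r)) := by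
    rw [(Submodule.equivMapOfInjective B hB _).finrank_eq]
    refine Submodule.finrank_mono (Submodule.map_le_iff_le_comap.2 fun v hv => ?_)
    rw [Submodule.mem_comap, Module.End.mem_eigenspace_iff, hAB,
      Module.End.mem_eigenspace_iff.1 hv, map_smul, neg_smul]
  have heq : Module.finrank L (A.eigenspace (-s)) = Module.finrank L (A.eigenspace s) :=
    le_antisymm ((hle (-s)).trans_eq (by rw [neg_neg])) (hle s)
  have hcompl : IsCompl (A.eigenspace s) (A.eigenspace (-s)) := by
    refine ⟨A.disjoint_genEigenspace (self_ne_neg.2 hs) 1 1, codisjoint_iff_le_sup.2 fun v _ => ?_⟩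
    have hv : v = (2 * s)⁻¹ • (s • v + A v) + (2 * s)⁻¹ • (s • v - A v) := by
      rw [← smul_add, add_add_sub_cancel, ← two_smul L (s • v), smul_smul, smul_smul,
        mul_assoc, inv_mul_cancel₀ (mul_ne_zero two_ne_zero hs), one_smul]
    rw [hv]
    refine Submodule.add_mem_sup (Submodule.smul_mem _ _ ?_) (Submodule.smul_mem _ _ ?_) <;>
      rw [Module.End.mem_eigenspace_iff] <;> simp only [map_smul, map_add, map_sub, hA] <;> module
  rw [← Submodule.finrank_add_eq_of_isCompl hcompl, heq, two_mul]

theorem exists_linearIndependent_eigenvectors_mem (hs : s ≠ 0) (hA : ∀ v, A (A v) = (s * s) • v)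
    (hAB : ∀ v, A (B v) = -B (A v)) (hB : Function.Injective B) {P : Submodule L E}
    (hPA : ∀ v ∈ P, A v ∈ P) (hPB : ∀ v ∈ P, B v ∈ P) {m : ℕ}
    (hP : Module.finrank L P = 2 * m) :
    ∃ e : Fin m → E, LinearIndependent L e ∧ ∀ i, e i ∈ P ∧ A (e i) = s • e i := by
  have hm : Module.finrank L (Module.End.eigenspace (A.restrict hPA) s) = m := by
    have := two_mul_finrank_eigenspace_of_anticommute (A := A.restrict hPA) (B := B.restrict hPB)
      hs (fun v => Subtype.ext (hA v)) (fun v => Subtype.ext (hAB v))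
      (fun v w h => Subtype.ext (hB (congrArg Subtype.val h)))
    omega
  rw [← Submodule.finrank_map_subtype_eq] at hm
  obtain ⟨e⟩ : Nonempty (Module.Basis (Fin m) L _) := ⟨Module.finBasisOfFinrankEq L _ hm⟩
  refine ⟨fun i => e i, e.linearIndependent.map' (Submodule.subtype _) (Submodule.ker_subtype _),
    fun i => ?_⟩
  obtain ⟨w, hw, hwe⟩ := (e i).2
  beta_reduce
  rw [← hwe]
  exact ⟨w.2, congrArg Subtype.val (Module.End.mem_eigenspace_iff.1 hw)⟩

end Anticommuting

theorem linearIndependent_of_mem_span_pair {I L E : Type*} [Field L] [AddCommGroup E] [Module L E]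
    {u v w : I → E} (h : LinearIndependent L (Sum.elim u w)) (hv : v ∈ Submodule.span L {u, w})
    (hv0 : v ≠ 0) : LinearIndependent L v := by
  obtain ⟨α, β, rfl⟩ := Submodule.mem_span_pair.1 hv
  obtain ⟨c, d, hcd⟩ : ∃ c d, α * c + β * d = 1 := by
    by_cases hα : α = 0
    · have hβ : β ≠ 0 := by rintro rfl; simp [hα] at hv0
      exact ⟨0, β⁻¹, by simp [hβ]⟩
    · exact ⟨α⁻¹, 0, by simp [hα]⟩
  obtain ⟨φ, hφ⟩ := exists_linearMap_apply_eq h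
    (Sum.elim (fun i => Finsupp.single i c) fun i => Finsupp.single i d)
  have hφv : φ ∘ (α • u + β • w) = fun i => Finsupp.single i 1 := by
    funext i
    have hl : φ (u i) = _ := hφ (.inl i)
    have hr : φ (w i) = _ := hφ (.inr i)
    simp only [Function.comp_apply, Pi.add_apply, Pi.smul_apply, map_add, map_smul, hl, hr,
      Sum.elim_inl, Sum.elim_inr, Finsupp.smul_single, smul_eq_mul, ← Finsupp.single_add, hcd]
  exact .of_comp φ (hφv ▸ Finsupp.linearIndependent_single_one L I)

section Orbit

variable {k R L E : Type*} [Field k] [Ring R] [Algebra k R] [Field L] [Algebra k L]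
  [AddCommGroup E] [Module L E] [Module k E] [IsScalarTower k L E]

/-- The representation of an algebra on the tuples of elements of a representation. -/
def tupleAction (T : R →ₐ[k] Module.End L E) (I : Type*) : R →ₐ[k] Module.End L (I → E) where
  toFun x := (T x).compLeft I
  map_one' := by ext; simp
  map_mul' x y := by ext; simp
  map_zero' := by ext; simp
  map_add' x y := by ext; simp
  commutes' c := by ext; simp

/-- The subrepresentation generated by a vector. -/
def orbitSpan (T : R →ₐ[k] Module.End L E) (v : E) : Submodule L E :=
  Submodule.span L (Set.range fun x => T x v)

variable {T : R →ₐ[k] Module.End L E}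

theorem mem_orbitSpan_self (v : E) : v ∈ orbitSpan T v :=
  Submodule.subset_span ⟨1, by simp⟩

theorem apply_mem_orbitSpan (x : R) {v w : E} (hw : w ∈ orbitSpan T v) : T x w ∈ orbitSpan T v := by
  refine Submodule.span_le (p := (orbitSpan T v).comap (T x)).2 ?_ hw
  rintro _ ⟨y, rfl⟩
  exact Submodule.subset_span ⟨x * y, by simp⟩

theorem orbitSpan_le_of_mem {v w : E} (hw : w ∈ orbitSpan T v) : orbitSpan T w ≤ orbitSpan T v := by
  rw [orbitSpan, Submodule.span_le]
  rintro _ ⟨x, rfl⟩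
  exact apply_mem_orbitSpan x hw

theorem decomposableSpan_orbitSpan_tupleAction [Infinite k] {N : ℕ} (u : Fin N → E) :
    decomposableSpan (orbitSpan (tupleAction T (Fin N)) u) =
      Submodule.span L
        (Set.range fun x => exteriorPower.ιMulti L N (tupleAction T (Fin N) x u)) := by
  let M : R →ₗ[k] Fin N → E :=
    { toFun := fun x => tupleAction T (Fin N) x u
      map_add' := fun x y => by rw [map_add, LinearMap.add_apply]
      map_smul' := fun c x => by rw [map_smul, LinearMap.smul_apply, RingHom.id_apply] }
  have h := span_ιMulti_image_eq_decomposableSpan (L := L) (LinearMap.range M)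
  rw [LinearMap.coe_range, ← Set.range_comp] at h
  exact h.symm

end Orbit

section RightAction

variable {F : Type*} [Ring F] [Algebra ℚ F] {L E : Type*} [Field L] [Algebra ℚ L] [AddCommGroup E]
  [Module L E] [Module ℚ E] [IsScalarTower ℚ L E] {T : Fᵐᵒᵖ →ₐ[ℚ] Module.End L E}
  {K : Subalgebra ℚ F} {a b : F} {σ σ' : K →ₐ[ℚ] L} {v : E}

/-- The vectors on which a subalgebra acts through a character. -/
def characterSpace (T : Fᵐᵒᵖ →ₐ[ℚ] Module.End L E) (σ : K →ₐ[ℚ] L) : Submodule L E :=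
  ⨅ x : K, Module.End.eigenspace (T (.op x)) (σ x)

theorem mem_characterSpace_iff : v ∈ characterSpace T σ ↔ ∀ x : K, T (.op x) v = σ x • v := by
  simp [characterSpace]

theorem mem_characterSpace_tupleAction_iff {I : Type*} {u : I → E} :
    u ∈ characterSpace (tupleAction T I) σ ↔ ∀ i, u i ∈ characterSpace T σ := by
  simp only [mem_characterSpace_iff, funext_iff]
  exact forall_comm

namespace IsQuaternionPair

theorem mem (h : IsQuaternionPair K a b) : a ∈ K :=
  h.toSubmodule_eq.ge (Submodule.subset_span (by simp))

/-- The generator `a` as an element of `K`. -/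
def gen (h : IsQuaternionPair K a b) : K := ⟨a, h.mem⟩

theorem exists_eq_smul_add_smul (h : IsQuaternionPair K a b) (y : K) :
    ∃ p q : ℚ, y = p • 1 + q • h.gen := by
  obtain ⟨p, q, hy⟩ := exists_eq_smul_one_add_smul h.toSubmodule_eq y
  exact ⟨p, q, Subtype.ext hy⟩

theorem algHom_ext (h : IsQuaternionPair K a b) (hσ : σ h.gen = σ' h.gen) : σ = σ' := by
  ext y
  obtain ⟨p, q, rfl⟩ := h.exists_eq_smul_add_smul y
  simp [hσ]

theorem apply_gen_eq_neg (h : IsQuaternionPair K a b) (hσ : σ ≠ σ') : σ' h.gen = -σ h.gen := by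
  obtain ⟨d, hd⟩ := Algebra.mem_bot.1 h.sq_mem
  have hgen : h.gen * h.gen = algebraMap ℚ K d := Subtype.ext hd.symm
  have hsq : σ' h.gen * σ' h.gen = σ h.gen * σ h.gen := by
    rw [← map_mul, ← map_mul, hgen, AlgHom.commutes, AlgHom.commutes]
  exact (mul_self_eq_mul_self_iff.1 hsq).resolve_left fun h' => hσ (h.algHom_ext h'.symm)

theorem apply_gen_ne_zero (h : IsQuaternionPair K a b) (hσ : σ ≠ σ') : σ h.gen ≠ 0 := fun h0 =>
  hσ (h.algHom_ext (by rw [h.apply_gen_eq_neg hσ, h0, neg_zero]))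

theorem mem_characterSpace_iff_apply_eq_smul (h : IsQuaternionPair K a b) :
    v ∈ characterSpace T σ ↔ T (.op a) v = σ h.gen • v := by
  refine mem_characterSpace_iff.trans ⟨fun hv => hv h.gen, fun hv y => ?_⟩
  obtain ⟨p, q, rfl⟩ := h.exists_eq_smul_add_smul y
  have hy : MulOpposite.op ((p • 1 + q • h.gen : K) : F) = p • 1 + q • .op a := rfl
  rw [hy, map_add, map_smul, map_smul, map_one, map_add, map_smul, map_smul, map_one,
    LinearMap.add_apply, LinearMap.smul_apply, LinearMap.smul_apply, hv, Module.End.one_apply,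
    add_smul, smul_assoc, smul_assoc, one_smul]

theorem apply_apply_eq_neg (h : IsQuaternionPair K a b) (v : E) :
    T (.op a) (T (.op b) v) = -T (.op b) (T (.op a) v) := by
  rw [← Module.End.mul_apply, ← map_mul, ← MulOpposite.op_mul, h.mul_eq_neg_mul, MulOpposite.op_neg,
    map_neg, MulOpposite.op_mul, map_mul]
  rfl

theorem apply_apply_self (h : IsQuaternionPair K a b) (σ : K →ₐ[ℚ] L) (v : E) :
    T (.op a) (T (.op a) v) = (σ h.gen * σ h.gen) • v := by
  obtain ⟨d, hd⟩ := Algebra.mem_bot.1 h.sq_mem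
  have hgen : h.gen * h.gen = algebraMap ℚ K d := Subtype.ext hd.symm
  rw [← Module.End.mul_apply, ← map_mul, ← MulOpposite.op_mul, ← hd, ← map_mul, hgen,
    ← MulOpposite.algebraMap_apply, AlgHom.commutes, AlgHom.commutes, Module.algebraMap_end_apply,
    algebraMap_smul]

theorem apply_injective (h : IsQuaternionPair K a b) : Function.Injective (T (.op b)) :=
  ((Module.End.isUnit_iff _).1 (h.isUnit.op.map T)).1

theorem apply_mem_characterSpace (h : IsQuaternionPair K a b) (hσ : σ ≠ σ')
    (hv : v ∈ characterSpace T σ) : T (.op b) v ∈ characterSpace T σ' := by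
  rw [h.mem_characterSpace_iff_apply_eq_smul] at hv ⊢
  rw [h.apply_apply_eq_neg, hv, map_smul, h.apply_gen_eq_neg hσ, neg_smul]

theorem orbitSpan_eq (h : IsQuaternionPair K a b) (hσ : σ ≠ σ')
    (hv : v ∈ characterSpace T σ) : orbitSpan T v = Submodule.span L {v, T (.op b) v} := by
  have hw := h.apply_mem_characterSpace hσ hv
  rw [mem_characterSpace_iff] at hv hw
  apply le_antisymm <;> rw [orbitSpan, Submodule.span_le]
  · rintro _ ⟨x, rfl⟩
    obtain ⟨y, z, hx⟩ := h.exists_eq x.unop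
    refine Submodule.mem_span_pair.2 ⟨σ y, σ' z, ?_⟩
    rw [← hv, ← hw, ← Module.End.mul_apply, ← map_mul, ← MulOpposite.op_mul, ← LinearMap.add_apply,
      ← map_add, ← MulOpposite.op_add, ← hx, MulOpposite.op_unop]
  · rw [Set.pair_subset_iff]
    exact ⟨mem_orbitSpan_self v, Submodule.subset_span ⟨_, rfl⟩⟩

theorem linearIndependent_sumElim (h : IsQuaternionPair K a b) (hσ : σ ≠ σ') {I : Type*} {u : I → E}
    (hu : LinearIndependent L u) (huσ : u ∈ characterSpace (tupleAction T I) σ) :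
    LinearIndependent L (Sum.elim u (tupleAction T I (.op b) u)) := by
  have hbu := h.apply_mem_characterSpace hσ huσ
  rw [mem_characterSpace_tupleAction_iff] at huσ hbu
  refine LinearIndependent.sum_type hu
    (hu.map' (T (.op b)) (LinearMap.ker_eq_bot.2 h.apply_injective)) ?_
  refine ((T (.op a)).disjoint_genEigenspace (fun h' => hσ (h.algHom_ext h')) 1 1).mono
    (Submodule.span_le.2 ?_) (Submodule.span_le.2 ?_)
  · rintro _ ⟨i, rfl⟩
    exact Module.End.mem_eigenspace_iff.2 (h.mem_characterSpace_iff_apply_eq_smul.1 (huσ i))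
  · rintro _ ⟨i, rfl⟩
    exact Module.End.mem_eigenspace_iff.2 (h.mem_characterSpace_iff_apply_eq_smul.1 (hbu i))

theorem finrank_orbitSpan (h : IsQuaternionPair K a b) (hσ : σ ≠ σ') (hv : v ∈ characterSpace T σ)
    (hv0 : v ≠ 0) : Module.finrank L (orbitSpan T v) = 2 := by
  have hli := h.linearIndependent_sumElim hσ (u := fun _ : Unit => v)
    (LinearIndependent.of_subsingleton () hv0) (mem_characterSpace_tupleAction_iff.2 fun _ => hv)
  have hrange : Set.range (Sum.elim (fun _ : Unit => v) (tupleAction T Unit (.op b) fun _ => v)) =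
      {v, T (.op b) v} := by
    rw [Set.Sum.elim_range, Set.range_const, Set.insert_eq]
    exact congrArg _ (Set.range_eq_singleton_iff.2 fun _ => rfl)
  rw [h.orbitSpan_eq hσ hv, ← hrange, finrank_span_eq_card hli]
  rfl

variable [CharZero L] [FiniteDimensional L E] {K' : Subalgebra ℚ F} {a' b' : F}
  {τ τ' : K' →ₐ[ℚ] L}

theorem exists_ne_zero_mem_characterSpace (h : IsQuaternionPair K a b) (hσ : σ ≠ σ')
    (hv : v ∈ characterSpace T σ) (hv0 : v ≠ 0) (h' : IsQuaternionPair K' a' b') (hτ : τ ≠ τ') :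
    ∃ w ∈ characterSpace T τ, w ≠ 0 ∧ orbitSpan T w = orbitSpan T v := by
  have hdim := h.finrank_orbitSpan hσ hv hv0
  obtain ⟨e, he, heV⟩ := exists_linearIndependent_eigenvectors_mem (h'.apply_gen_ne_zero hτ)
    (h'.apply_apply_self τ) h'.apply_apply_eq_neg h'.apply_injective
    (fun _ => apply_mem_orbitSpan (T := T) (.op a'))
    (fun _ => apply_mem_orbitSpan (T := T) (.op b')) (m := 1) hdim
  have hw := h'.mem_characterSpace_iff_apply_eq_smul.2 (heV 0).2
  refine ⟨e 0, hw, he.ne_zero 0,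
    Submodule.eq_of_le_of_finrank_eq (orbitSpan_le_of_mem (heV 0).1) ?_⟩
  rw [hdim, h'.finrank_orbitSpan hτ hw (he.ne_zero 0)]

theorem exists_linearIndependent_orbitSpan_eq {I : Type*} [Finite I] (h : IsQuaternionPair K a b)
    (hσ : σ ≠ σ') (h' : IsQuaternionPair K' a' b') (hτ : τ ≠ τ') {u : I → E}
    (hu : LinearIndependent L u) (huσ : u ∈ characterSpace (tupleAction T I) σ) :
    ∃ w : I → E, LinearIndependent L w ∧ w ∈ characterSpace (tupleAction T I) τ ∧
      orbitSpan (tupleAction T I) w = orbitSpan (tupleAction T I) u := by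
  rcases isEmpty_or_nonempty I
  · exact ⟨u, hu, mem_characterSpace_tupleAction_iff.2 isEmptyElim, rfl⟩
  · obtain ⟨w, hw, hw0, hwu⟩ := h.exists_ne_zero_mem_characterSpace hσ huσ (fun h0 =>
      hu.ne_zero (Classical.arbitrary I) (congrFun h0 _)) h' hτ
    refine ⟨w, linearIndependent_of_mem_span_pair (h.linearIndependent_sumElim hσ hu huσ) ?_ hw0,
      hw, hwu⟩
    rw [← h.orbitSpan_eq hσ huσ, ← hwu]
    exact mem_orbitSpan_self w

end IsQuaternionPair

end RightAction

/-! ### Cohomology of a complex torus -/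

section TorusCohomology

variable {V : Type*} [NormedAddCommGroup V] (Λ : Submodule ℤ V)

theorem cohQToC_ιMulti (k : ℕ) (v : Fin k → torusCohQ1 Λ) :
    cohQToC Λ k (exteriorPower.ιMulti ℚ k v) =
      exteriorPower.ιMulti ℂ k fun i => cohQ1ToC1 Λ (v i) :=
  exteriorPower.alternatingMapLinearEquiv_apply_ιMulti ..

/-- Complex conjugation on `H¹(A, ℂ)`. -/
def cohConj : torusCohC1 Λ ≃ₛₗ[starRingEnd ℂ] torusCohC1 Λ :=
  .ofInvolutive
    { toFun := fun f => (starRingEnd ℂ).toIntAlgHom.toLinearMap ∘ₗ f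
      map_add' := fun f g => by ext; simp
      map_smul' := fun c f => by ext; simp }
    fun f => by ext; simp

variable [NormedSpace ℂ V]

/-- The action of `End(A)` on `H¹(A, ℂ) = Hom(Λ, ℂ)` by pullback, which reverses products. -/
def integralPullback : torusEnd Λ →ₐ[ℤ] (Module.End ℂ (torusCohC1 Λ))ᵐᵒᵖ :=
  RingHom.toIntAlgHom
    { toFun := fun φ => .op
        { toFun := fun f => f ∘ₗ integralRep Λ φ
          map_add' := fun _ _ => rfl
          map_smul' := fun _ _ => rfl }
      map_one' := rfl
      map_mul' := fun _ _ => rfl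
      map_zero' := MulOpposite.unop_injective (by ext; simp)
      map_add' := fun _ _ => MulOpposite.unop_injective (by ext; simp) }

/-- The right action of `End(A) ⊗ ℚ` on `H¹(A, ℂ)` by pullback. -/
def pullbackC1 : (torusEndQ Λ)ᵐᵒᵖ →ₐ[ℚ] Module.End ℂ (torusCohC1 Λ) :=
  AlgHom.opComm (Algebra.TensorProduct.lift (Algebra.ofId ℚ _) (integralPullback Λ)
    fun q _ => Algebra.commutes q _)

theorem pullbackC1_tmul (q : ℚ) (φ : torusEnd Λ) (f : torusCohC1 Λ) :
    pullbackC1 Λ (.op (q ⊗ₜ φ)) f = q • (f ∘ₗ integralRep Λ φ) := by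
  change (Algebra.ofId ℚ (Module.End ℂ (torusCohC1 Λ))ᵐᵒᵖ q * integralPullback Λ φ).unop f = _
  rw [Algebra.ofId_apply, ← Algebra.smul_def]
  rfl

theorem rationalRep_tmul (q : ℚ) (φ : torusEnd Λ) (v : Λ) :
    rationalRep Λ (q ⊗ₜ φ) (1 ⊗ₜ v) = q • 1 ⊗ₜ integralRep Λ φ v := rfl

theorem pullbackC1_cohQ1ToC1 (x : torusEndQ Λ) (f : torusCohQ1 Λ) :
    pullbackC1 Λ (.op x) (cohQ1ToC1 Λ f) = cohQ1ToC1 Λ ((rationalRep Λ x).dualMap f) := by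
  induction x using TensorProduct.induction_on with
  | zero => ext; simp [cohQ1ToC1]
  | add x y hx hy =>
    rw [MulOpposite.op_add, map_add, LinearMap.add_apply, hx, hy, ← map_add,
      map_add (rationalRep Λ)]
    exact congrArg _ (LinearMap.ext fun h => (map_add f _ _).symm)
  | tmul q φ =>
    ext v
    simp [pullbackC1_tmul, cohQ1ToC1, rationalRep_tmul, Rat.smul_def]

theorem pullbackC1_mem_of_forall_comp_mem {P : Submodule ℂ (torusCohC1 Λ)}
    (hP : ∀ φ : torusEnd Λ, ∀ f ∈ P, f ∘ₗ integralRep Λ φ ∈ P) (x : (torusEndQ Λ)ᵐᵒᵖ)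
    {f : torusCohC1 Λ} (hf : f ∈ P) : pullbackC1 Λ x f ∈ P := by
  induction x using MulOpposite.rec' with | _ x => ?_
  induction x using TensorProduct.induction_on with
  | zero => simp
  | add x y hx hy => rw [MulOpposite.op_add, map_add]; exact P.add_mem hx hy
  | tmul q φ =>
    rw [pullbackC1_tmul, ← Rat.cast_smul_eq_qsmul ℂ]
    exact P.smul_mem _ (hP φ f hf)

theorem pullbackC1_mem_hodge10 (x : (torusEndQ Λ)ᵐᵒᵖ) {f : torusCohC1 Λ} (hf : f ∈ hodge10 Λ) :
    pullbackC1 Λ x f ∈ hodge10 Λ :=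
  pullbackC1_mem_of_forall_comp_mem Λ (P := hodge10 Λ)
    (fun φ _ ⟨g, hg⟩ => ⟨g ∘ₗ φ.1, fun _ => hg _⟩) x hf

theorem pullbackC1_mem_hodge01 (x : (torusEndQ Λ)ᵐᵒᵖ) {f : torusCohC1 Λ} (hf : f ∈ hodge01 Λ) :
    pullbackC1 Λ x f ∈ hodge01 Λ :=
  pullbackC1_mem_of_forall_comp_mem Λ (P := hodge01 Λ)
    (fun φ _ ⟨g, hg⟩ => ⟨g.comp φ.1, fun _ => hg _⟩) x hf

theorem cohQToC_cohAction (k : ℕ) (x : torusEndQ Λ) (w : torusCohQ Λ k) :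
    cohQToC Λ k (cohAction k x w) =
      exteriorPower.map k (pullbackC1 Λ (.op x)) (cohQToC Λ k w) := by
  have h : cohQToC Λ k ∘ₗ cohAction k x =
      (exteriorPower.map k (pullbackC1 Λ (.op x))).restrictScalars ℚ ∘ₗ cohQToC Λ k := by
    refine exteriorPower.linearMap_ext (AlternatingMap.ext fun v => ?_)
    simp only [LinearMap.compAlternatingMap_apply, LinearMap.comp_apply, cohAction,
      exteriorPower.map_apply_ιMulti, cohQToC_ιMulti, LinearMap.restrictScalars_apply]
    exact congrArg _ (funext fun i => (pullbackC1_cohQ1ToC1 Λ x (v i)).symm)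
  exact LinearMap.congr_fun h w

theorem map_cohConj_hodge10 :
    (hodge10 Λ).map (cohConj Λ : torusCohC1 Λ →ₛₗ[starRingEnd ℂ] torusCohC1 Λ) = hodge01 Λ := by
  ext f
  constructor
  · rintro ⟨f, ⟨g, hg⟩, rfl⟩
    refine ⟨(starLinearEquiv ℂ : ℂ ≃ₗ⋆[ℂ] ℂ).toLinearMap.comp g, fun v => ?_⟩
    exact congrArg (starRingEnd ℂ) (hg v)
  · rintro ⟨g, hg⟩
    refine ⟨cohConj Λ f, ⟨(starLinearEquiv ℂ : ℂ ≃ₗ⋆[ℂ] ℂ).toLinearMap.comp g, fun v => ?_⟩, ?_⟩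
    · exact congrArg (starRingEnd ℂ) (hg v)
    · exact (cohConj Λ).apply_symm_apply f

theorem finrank_hodge01_eq_finrank_hodge10 :
    Module.finrank ℂ (hodge01 Λ) = Module.finrank ℂ (hodge10 Λ) := by
  have e := (cohConj Λ).submoduleMap (hodge10 Λ)
  rw [map_cohConj_hodge10] at e
  exact congrArg Cardinal.toNat (rank_eq_of_equiv_equiv (starRingEnd ℂ) e.toAddEquiv
    (starRingAut (R := ℂ)).bijective e.map_smulₛₗ).symm

variable [DiscreteTopology Λ] [IsZLattice ℝ Λ]

variable {Λ}

theorem realLinearMap_ext_of_lattice {W : Type*} [AddCommGroup W] [Module ℝ W] {g g' : V →ₗ[ℝ] W}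
    (h : ∀ v : Λ, g v = g' v) : g = g' :=
  LinearMap.ext_on (IsZLattice.span_top (K := ℝ) (L := Λ)) fun v hv => h ⟨v, hv⟩

variable (Λ)

theorem disjoint_hodge10_hodge01 : Disjoint (hodge10 Λ) (hodge01 Λ) := by
  rw [← map_cohConj_hodge10, Submodule.disjoint_def]
  rintro _ ⟨g, hg⟩ ⟨f, ⟨g', hg'⟩, rfl⟩
  have heq : g.restrictScalars ℝ =
      Complex.conjLIE.toLinearMap ∘ₗ g'.restrictScalars ℝ :=
    realLinearMap_ext_of_lattice (Λ := Λ) fun v =>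
      (hg v).symm.trans (congrArg (starRingEnd ℂ) (hg' v))
  have hgg (v : V) : g v = starRingEnd ℂ (g' v) := LinearMap.congr_fun heq v
  ext v
  have hI := hgg (Complex.I • (v : V))
  rw [map_smul, map_smul, smul_eq_mul, smul_eq_mul, map_mul, ← hgg, Complex.conj_I, neg_mul,
    eq_neg_iff_add_eq_zero, ← two_mul] at hI
  exact (hg v).trans (by simpa using hI)

theorem finrank_hodge10 : Module.finrank ℂ (hodge10 Λ) = Module.finrank ℂ V := by
  let r : Module.Dual ℂ V →ₗ[ℂ] torusCohC1 Λ :=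
    { toFun := fun g => g.restrictScalars ℤ ∘ₗ Λ.subtype
      map_add' := fun _ _ => rfl
      map_smul' := fun _ _ => rfl }
  have hr : Function.Injective r := fun g g' h => LinearMap.restrictScalars_injective ℝ
    (realLinearMap_ext_of_lattice (Λ := Λ) fun v => LinearMap.congr_fun h v)
  have hrange : LinearMap.range r = hodge10 Λ := by
    ext f
    exact ⟨fun ⟨g, hg⟩ => ⟨g, fun v => (LinearMap.congr_fun hg v).symm⟩,
      fun ⟨g, hg⟩ => ⟨g, LinearMap.ext fun v => (hg v).symm⟩⟩
  rw [← hrange, LinearMap.finrank_range_of_inj hr, Subspace.dual_finrank_eq]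

variable [FiniteDimensional ℂ V]

theorem exists_basis_cohQ1_cohC1 :
    ∃ (b : Module.Basis (Fin (Module.finrank ℤ Λ)) ℚ (torusCohQ1 Λ))
      (b' : Module.Basis (Fin (Module.finrank ℤ Λ)) ℂ (torusCohC1 Λ)),
      ∀ i, cohQ1ToC1 Λ (b i) = b' i := by
  have : FiniteDimensional ℝ V := FiniteDimensional.complexToReal V
  have : Module.Free ℤ Λ := ZLattice.module_free ℝ Λ
  have : Module.Finite ℤ Λ := ZLattice.module_finite ℝ Λ
  let c := Module.finBasis ℤ Λ
  refine ⟨(c.baseChange ℚ).dualBasis, .ofEquivFun (c.constr ℂ).symm, fun i => c.ext fun j => ?_⟩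
  have hdual : (c.baseChange ℚ).dualBasis i ((1 : ℚ) ⊗ₜ[ℤ] c j) = if j = i then 1 else 0 := by
    rw [← c.baseChange_apply ℚ, Module.Basis.dualBasis_apply_self]
  change (((c.baseChange ℚ).dualBasis i ((1 : ℚ) ⊗ₜ[ℤ] c j) : ℚ) : ℂ) = _
  rw [hdual]
  split_ifs with h <;> simp [Pi.single_apply, h]

theorem isBaseChange_cohQToC (k : ℕ) : IsBaseChange ℂ (cohQToC Λ k) := by
  obtain ⟨b, b', h⟩ := exists_basis_cohQ1_cohC1 Λ
  refine isBaseChange_of_map_basis (b.exteriorPower k) (b'.exteriorPower k) fun s => ?_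
  simp only [exteriorPower.basis_apply, exteriorPower.ιMulti_family, cohQToC_ιMulti]
  exact congrArg _ (funext fun i => h _)

instance finiteDimensional_torusCohC1 : FiniteDimensional ℂ (torusCohC1 Λ) :=
  let ⟨_, b', _⟩ := exists_basis_cohQ1_cohC1 Λ
  .of_basis b'

theorem finrank_torusCohC1 : Module.finrank ℂ (torusCohC1 Λ) = 2 * Module.finrank ℂ V := by
  have : FiniteDimensional ℝ V := FiniteDimensional.complexToReal V
  obtain ⟨_, b', _⟩ := exists_basis_cohQ1_cohC1 Λ
  rw [Module.finrank_eq_card_basis b', Fintype.card_fin, ZLattice.rank ℝ Λ,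
    finrank_real_of_complex]

end TorusCohomology

/-! ### Quaternion classes -/

theorem IsDefiniteQuaternionAlgebra.isSimpleRing {F : Type*} [Ring F] [Algebra ℚ F]
    (hF : IsDefiniteQuaternionAlgebra F) : IsSimpleRing F := by
  classical
  have : Nontrivial F := Module.nontrivial_of_finrank_pos (R := ℚ) (by rw [hF.finrank_eq]; simp)
  let := DivisionRing.ofIsUnitOrEqZero fun x : F => or_iff_not_imp_right.2 (hF.isUnit_of_ne_zero x)
  infer_instance

theorem linearIndependent_append_of_disjoint {L E : Type*} [Field L] [AddCommGroup E] [Module L E]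
    {P Q : Submodule L E} (hPQ : Disjoint P Q) {m n : ℕ} {v : Fin m → E} {w : Fin n → E}
    (hv : LinearIndependent L v) (hw : LinearIndependent L w) (hvP : ∀ i, v i ∈ P)
    (hwQ : ∀ i, w i ∈ Q) : LinearIndependent L (Fin.append v w) := by
  rw [← linearIndependent_equiv finSumFinEquiv]
  have h := hv.sum_type hw (hPQ.mono (Submodule.span_le.2 (Set.range_subset_iff.2 hvP))
    (Submodule.span_le.2 (Set.range_subset_iff.2 hwQ)))
  rwa [← Fin.append_comp_sumElim] at h

section QuaternionClasses

variable {V : Type*} [NormedAddCommGroup V] [NormedSpace ℂ V] {Λ : Submodule ℤ V} {F : Type*}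
  [Ring F] [Algebra ℚ F] (ι : F →ₐ[ℚ] torusEndQ Λ) {n : ℕ} {K : Subalgebra ℚ F}

/-- The right action of `F ⊂ End(A) ⊗ ℚ` on `H¹(A, ℂ)` by pullback. -/
def quaternionPullback : Fᵐᵒᵖ →ₐ[ℚ] Module.End ℂ (torusCohC1 Λ) :=
  (pullbackC1 Λ).comp (AlgHom.op ι)

theorem span_cohQToC_map_cohAction (k : ℕ) (x : F) (W : Submodule ℚ (torusCohQ Λ k)) :
    Submodule.span ℂ (cohQToC Λ k '' W.map (cohAction k (ι x))) =
      (Submodule.span ℂ (cohQToC Λ k '' W)).map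
        (exteriorPower.map k (quaternionPullback ι (.op x))) := by
  rw [Submodule.map_span, Submodule.map_coe, Set.image_image, Set.image_image]
  exact congrArg _ (Set.image_congr' fun w => cohQToC_cohAction Λ k (ι x) w)

theorem decomposableSpan_orbitSpan_le_hodgePiece {p q k : ℕ} (hk : p + q = k)
    {u : Fin k → torusCohC1 Λ} (hu10 : ∀ i : Fin k, (i : ℕ) < p → u i ∈ hodge10 Λ)
    (hu01 : ∀ i : Fin k, p ≤ (i : ℕ) → u i ∈ hodge01 Λ) :
    decomposableSpan (orbitSpan (tupleAction (quaternionPullback ι) (Fin k)) u) ≤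
      hodgePiece Λ p q hk := by
  rw [decomposableSpan_orbitSpan_tupleAction]
  refine Submodule.span_mono ?_
  rintro _ ⟨x, rfl⟩
  exact ⟨_, fun i hi => pullbackC1_mem_hodge10 Λ _ (hu10 i hi),
    fun i hi => pullbackC1_mem_hodge01 Λ _ (hu01 i hi), rfl⟩

variable [DiscreteTopology Λ] [IsZLattice ℝ Λ] [FiniteDimensional ℂ V] {a b : F}
  {σ σ' : K →ₐ[ℚ] ℂ} {u : Fin (2 * n) → torusCohC1 Λ}

theorem span_cohQToC_weilKernel (hK : IsQuadraticSubfield K) (hσ : σ ≠ σ') (x : K) :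
    Submodule.span ℂ (cohQToC Λ (2 * n) '' weilKernel ι n K x) =
      LinearMap.ker
        ((exteriorPower.map (2 * n) (quaternionPullback ι (.op x)) -
            algebraMap ℂ _ (σ x ^ (2 * n))) *
          (exteriorPower.map (2 * n) (quaternionPullback ι (.op x)) -
            algebraMap ℂ _ (σ' x ^ (2 * n)))) := by
  refine span_image_ker_of_isBaseChange (isBaseChange_cohQToC Λ (2 * n)) fun w => ?_
  have hx (w) : cohQToC Λ (2 * n) (cohAction (2 * n) (ι x) w) =
      exteriorPower.map (2 * n) (quaternionPullback ι (.op x)) (cohQToC Λ (2 * n) w) :=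
    cohQToC_cohAction Λ (2 * n) (ι x) w
  rw [← map_pow σ, ← map_pow σ']
  simp only [LinearMap.add_apply, LinearMap.sub_apply, LinearMap.smul_apply, pow_two,
    Module.End.mul_apply, Module.End.one_apply, map_add, map_sub, map_smul, hx,
    Module.algebraMap_end_apply, ← Rat.cast_smul_eq_qsmul ℂ, hK.trace_mulLeft_eq_add hσ,
    hK.det_mulLeft_eq_mul hσ]
  module

theorem span_ιMulti_pair_le_span_cohQToC_weilKernel (hK : IsQuadraticSubfield K) (hσ : σ ≠ σ')
    {v w : Fin (2 * n) → torusCohC1 Λ}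
    (hv : v ∈ characterSpace (tupleAction (quaternionPullback ι) (Fin (2 * n))) σ)
    (hw : w ∈ characterSpace (tupleAction (quaternionPullback ι) (Fin (2 * n))) σ') (x : K) :
    Submodule.span ℂ {exteriorPower.ιMulti ℂ (2 * n) v, exteriorPower.ιMulti ℂ (2 * n) w} ≤
      Submodule.span ℂ (cohQToC Λ (2 * n) '' weilKernel ι n K x) := by
  rw [mem_characterSpace_tupleAction_iff] at hv hw
  rw [span_cohQToC_weilKernel ι hK hσ, Submodule.span_le, Set.pair_subset_iff]
  have hv' := exteriorPower_map_ιMulti_of_apply_eq_smul fun i => mem_characterSpace_iff.1 (hv i) x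
  have hw' := exteriorPower_map_ιMulti_of_apply_eq_smul fun i => mem_characterSpace_iff.1 (hw i) x
  exact ⟨(mul_sub_algebraMap_apply_of_apply_eq_smul hv' _ _).trans (by simp),
    (mul_sub_algebraMap_apply_of_apply_eq_smul hw' _ _).trans (by simp)⟩

theorem IsQuaternionPair.exists_basis_torusCohC1 (h : IsQuaternionPair K a b) (hσ : σ ≠ σ')
    (hn : Module.finrank ℂ V = 2 * n) (hu : LinearIndependent ℂ u)
    (huσ : u ∈ characterSpace (tupleAction (quaternionPullback ι) (Fin (2 * n))) σ) :
    ∃ B : Module.Basis (Fin (2 * n) ⊕ Fin (2 * n)) ℂ (torusCohC1 Λ),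
      B ∘ Sum.inl = u ∧ B ∘ Sum.inr = tupleAction (quaternionPullback ι) _ (.op b) u := by
  have hli := h.linearIndependent_sumElim hσ hu huσ
  have hspan := hli.span_eq_top_of_card_eq_finrank'
    (by rw [finrank_torusCohC1, hn, Fintype.card_sum, Fintype.card_fin, two_mul (2 * n)])
  refine ⟨.mk hli hspan.ge, ?_⟩
  rw [Module.Basis.coe_mk]
  exact ⟨rfl, rfl⟩

theorem IsQuaternionPair.exists_span_cohQToC_weilKernel_eq (h : IsQuaternionPair K a b)
    (hK : IsQuadraticSubfield K) (hσ : σ ≠ σ') (hn : Module.finrank ℂ V = 2 * n)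
    (hu : LinearIndependent ℂ u)
    (huσ : u ∈ characterSpace (tupleAction (quaternionPullback ι) (Fin (2 * n))) σ) :
    ∃ x : K, Submodule.span ℂ (cohQToC Λ (2 * n) '' weilKernel ι n K x) =
      Submodule.span ℂ {exteriorPower.ιMulti ℂ (2 * n) u, exteriorPower.ιMulti ℂ (2 * n)
        (tupleAction (quaternionPullback ι) _ (.op b) u)} := by
  obtain ⟨B, hBl, hBr⟩ := h.exists_basis_torusCohC1 ι hσ hn hu huσ
  obtain ⟨t, ht, ht', hpow⟩ :=
    exists_pow_add_ne_pow_add (k := ℚ) (fun h' => hσ (h.algHom_ext h')) (2 * n)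
  have hu' := h.apply_mem_characterSpace hσ huσ
  rw [← hBr] at hu'
  rw [← hBl] at huσ
  rw [mem_characterSpace_tupleAction_iff] at huσ hu'
  have hσt : σ (algebraMap ℚ K t + h.gen) = algebraMap ℚ ℂ t + σ h.gen := by
    rw [map_add, AlgHom.commutes]
  have hσt' : σ' (algebraMap ℚ K t + h.gen) = algebraMap ℚ ℂ t + σ' h.gen := by
    rw [map_add, AlgHom.commutes]
  rw [← hσt] at ht
  rw [← hσt'] at ht'
  rw [← hσt, ← hσt'] at hpow
  refine ⟨algebraMap ℚ K t + h.gen, ?_⟩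
  rw [span_cohQToC_weilKernel ι hK hσ, ker_exteriorPower_map_eq_span_pair B ht ht' hpow
    (fun i => mem_characterSpace_iff.1 (huσ i) _)
    (fun i => mem_characterSpace_iff.1 (hu' i) _), hBl, hBr]

theorem IsQuaternionPair.span_cohQToC_weilClasses (h : IsQuaternionPair K a b)
    (hK : IsQuadraticSubfield K) (hσ : σ ≠ σ') (hn : Module.finrank ℂ V = 2 * n)
    (hu : LinearIndependent ℂ u)
    (huσ : u ∈ characterSpace (tupleAction (quaternionPullback ι) (Fin (2 * n))) σ) :
    Submodule.span ℂ (cohQToC Λ (2 * n) '' weilClasses ι n K) =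
      Submodule.span ℂ {exteriorPower.ιMulti ℂ (2 * n) u, exteriorPower.ιMulti ℂ (2 * n)
        (tupleAction (quaternionPullback ι) _ (.op b) u)} := by
  obtain ⟨x, hx⟩ := h.exists_span_cohQToC_weilKernel_eq ι hK hσ hn hu huσ
  have hW : weilClasses ι n K = weilKernel ι n K x := le_antisymm (iInf_le _ x) (le_iInf fun y =>
    le_of_span_image_le_of_isBaseChange (isBaseChange_cohQToC Λ (2 * n)) (hx.trans_le
      (span_ιMulti_pair_le_span_cohQToC_weilKernel ι hK hσ huσ
        (h.apply_mem_characterSpace hσ huσ) y)))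
  rw [hW, hx]

theorem IsQuaternionPair.span_cohQToC_quaternionClasses (h : IsQuaternionPair K a b)
    (hK : IsQuadraticSubfield K) (hσ : σ ≠ σ') (hn : Module.finrank ℂ V = 2 * n)
    (hu : LinearIndependent ℂ u)
    (huσ : u ∈ characterSpace (tupleAction (quaternionPullback ι) (Fin (2 * n))) σ) :
    Submodule.span ℂ (cohQToC Λ (2 * n) '' quaternionClasses ι n K) =
      decomposableSpan (orbitSpan (tupleAction (quaternionPullback ι) (Fin (2 * n))) u) := by
  let T := tupleAction (quaternionPullback ι) (Fin (2 * n))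
  have htranslate (x : F) : Submodule.span ℂ
      (cohQToC Λ (2 * n) '' (weilClasses ι n K).map (cohAction (2 * n) (ι x))) =
        Submodule.span ℂ {exteriorPower.ιMulti ℂ (2 * n) (T (.op x) u),
          exteriorPower.ιMulti ℂ (2 * n) (T (.op (b * x)) u)} := by
    rw [span_cohQToC_map_cohAction, h.span_cohQToC_weilClasses ι hK hσ hn hu huσ,
      Submodule.map_span, Set.image_pair, exteriorPower.map_apply_ιMulti,
      exteriorPower.map_apply_ιMulti, MulOpposite.op_mul, map_mul]
    rfl
  rw [decomposableSpan_orbitSpan_tupleAction, quaternionClasses, span_image_iSup]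
  simp only [htranslate]
  apply le_antisymm
  · exact iSup_le fun x => Submodule.span_mono (Set.pair_subset_iff.2 ⟨⟨_, rfl⟩, ⟨_, rfl⟩⟩)
  · rw [Submodule.span_le]
    rintro _ ⟨x, rfl⟩
    exact Submodule.mem_iSup_of_mem x.unop (Submodule.subset_span (Set.mem_insert _ _))

theorem IsQuaternionPair.exists_hodge_eigenvectors (h : IsQuaternionPair K a b) (hσ : σ ≠ σ')
    (hn : Module.finrank ℂ V = 2 * n) {N : ℕ} (hN : n + n = N) :
    ∃ u : Fin N → torusCohC1 Λ, LinearIndependent ℂ u ∧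
      u ∈ characterSpace (tupleAction (quaternionPullback ι) (Fin N)) σ ∧
      (∀ i : Fin N, (i : ℕ) < n → u i ∈ hodge10 Λ) ∧
      ∀ i : Fin N, n ≤ (i : ℕ) → u i ∈ hodge01 Λ := by
  subst hN
  have hex {P : Submodule ℂ (torusCohC1 Λ)} (hP : ∀ x, ∀ f ∈ P, quaternionPullback ι x f ∈ P)
      (hPn : Module.finrank ℂ P = 2 * n) : ∃ e : Fin n → torusCohC1 Λ, LinearIndependent ℂ e ∧
        ∀ i, e i ∈ P ∧ e i ∈ characterSpace (quaternionPullback ι) σ := by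
    simp only [h.mem_characterSpace_iff_apply_eq_smul]
    exact exists_linearIndependent_eigenvectors_mem (h.apply_gen_ne_zero hσ) (h.apply_apply_self σ)
      h.apply_apply_eq_neg h.apply_injective (hP (.op a)) (hP (.op b)) hPn
  have h10 := (finrank_hodge10 Λ).trans hn
  have h01 := (finrank_hodge01_eq_finrank_hodge10 Λ).trans h10
  obtain ⟨e, he, heP⟩ := hex (fun x _ => pullbackC1_mem_hodge10 Λ _) h10
  obtain ⟨e', he', heP'⟩ := hex (fun x _ => pullbackC1_mem_hodge01 Λ _) h01
  refine ⟨Fin.append e e', linearIndependent_append_of_disjoint (disjoint_hodge10_hodge01 Λ) he he'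
    (fun i => (heP i).1) (fun i => (heP' i).1), mem_characterSpace_tupleAction_iff.2 ?_, ?_, ?_⟩
  · exact Fin.addCases (fun i => by simpa using (heP i).2) fun i => by
      simpa only [Fin.append_right] using (heP' i).2
  · exact Fin.addCases (fun i _ => by simpa using (heP i).1)
      fun i hi => absurd hi (by simp)
  · exact Fin.addCases (fun i hi => absurd i.2 hi.not_gt) fun i _ => by
      simpa only [Fin.append_right] using (heP' i).1

namespace IsQuadraticSubfield

variable [IsSimpleRing F] [Algebra.IsCentral ℚ F] {K' : Subalgebra ℚ F}

theorem quaternionClasses_eq (hF : Module.finrank ℚ F = 4) (hn : Module.finrank ℂ V = 2 * n)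
    (hK : IsQuadraticSubfield K) (hK' : IsQuadraticSubfield K') :
    quaternionClasses ι n K = quaternionClasses ι n K' := by
  obtain ⟨a, b, h⟩ := hK.exists_isQuaternionPair hF
  obtain ⟨a', b', h'⟩ := hK'.exists_isQuaternionPair hF
  obtain ⟨σ, σ', hσ⟩ := hK.exists_algHom_ne
  obtain ⟨τ, τ', hτ⟩ := hK'.exists_algHom_ne
  obtain ⟨u, hu, huσ, -⟩ := h.exists_hodge_eigenvectors ι hσ hn (two_mul n).symm
  obtain ⟨w, hw, hwτ, hwu⟩ := h.exists_linearIndependent_orbitSpan_eq hσ h' hτ hu huσ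
  have hspan : Submodule.span ℂ (cohQToC Λ (2 * n) '' quaternionClasses ι n K) =
      Submodule.span ℂ (cohQToC Λ (2 * n) '' quaternionClasses ι n K') := by
    rw [h.span_cohQToC_quaternionClasses ι hK hσ hn hu huσ,
      h'.span_cohQToC_quaternionClasses ι hK' hτ hn hw hwτ, hwu]
  have hbc := isBaseChange_cohQToC Λ (2 * n)
  exact le_antisymm (le_of_span_image_le_of_isBaseChange hbc hspan.le)
    (le_of_span_image_le_of_isBaseChange hbc hspan.ge)

theorem cohQToC_mem_hodgePiece (hF : Module.finrank ℚ F = 4) (hn : Module.finrank ℂ V = 2 * n)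
    (hK : IsQuadraticSubfield K) {w : torusCohQ Λ (2 * n)} (hw : w ∈ quaternionClasses ι n K) :
    cohQToC Λ (2 * n) w ∈ hodgePiece Λ n n (two_mul n).symm := by
  obtain ⟨a, b, h⟩ := hK.exists_isQuaternionPair hF
  obtain ⟨σ, σ', hσ⟩ := hK.exists_algHom_ne
  obtain ⟨u, hu, huσ, hu10, hu01⟩ := h.exists_hodge_eigenvectors ι hσ hn (two_mul n).symm
  refine decomposableSpan_orbitSpan_le_hodgePiece ι _ hu10 hu01 ?_
  rw [← h.span_cohQToC_quaternionClasses ι hK hσ hn hu huσ]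
  exact Submodule.subset_span (Set.mem_image_of_mem _ hw)

theorem finrank_quaternionClasses (hF : Module.finrank ℚ F = 4)
    (hn : Module.finrank ℂ V = 2 * n) (hK : IsQuadraticSubfield K) :
    Module.finrank ℚ (quaternionClasses ι n K) = 2 * n + 1 := by
  obtain ⟨a, b, h⟩ := hK.exists_isQuaternionPair hF
  obtain ⟨σ, σ', hσ⟩ := hK.exists_algHom_ne
  obtain ⟨u, hu, huσ, -⟩ := h.exists_hodge_eigenvectors ι hσ hn (two_mul n).symm
  rw [← finrank_span_image_of_isBaseChange (isBaseChange_cohQToC Λ (2 * n)),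
    h.span_cohQToC_quaternionClasses ι hK hσ hn hu huσ, h.orbitSpan_eq hσ huσ,
    finrank_decomposableSpan_span_pair (h.linearIndependent_sumElim hσ hu huσ)]

end IsQuadraticSubfield

end QuaternionClasses

theorem proposition4p7_general {V : Type*} [NormedAddCommGroup V] [NormedSpace ℂ V]
    [FiniteDimensional ℂ V] (Λ : Submodule ℤ V) [DiscreteTopology Λ] [IsZLattice ℝ Λ]
    {F : Type*} [Ring F] [Algebra ℚ F] [IsSimpleRing F] [Algebra.IsCentral ℚ F]
    (hF : Module.finrank ℚ F = 4) (ι : F →ₐ[ℚ] torusEndQ Λ) (n : ℕ)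
    (hn : Module.finrank ℂ V = 2 * n) :
    (∀ K K' : Subalgebra ℚ F, IsQuadraticSubfield K → IsQuadraticSubfield K' →
      quaternionClasses ι n K = quaternionClasses ι n K') ∧
    (∀ K : Subalgebra ℚ F, IsQuadraticSubfield K →
      (∀ w ∈ quaternionClasses ι n K,
        cohQToC Λ (2 * n) w ∈ hodgePiece Λ n n (two_mul n).symm) ∧
      Module.finrank ℚ (quaternionClasses ι n K) = 2 * n + 1) :=
  ⟨fun _ _ hK hK' => hK.quaternionClasses_eq ι hF hn hK', fun _ hK =>
    ⟨fun _ hw => hK.cohQToC_mem_hodgePiece ι hF hn hw, hK.finrank_quaternionClasses ι hF hn⟩⟩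

end

theorem proposition4p7 {V : Type*} [NormedAddCommGroup V] [NormedSpace ℂ V] [FiniteDimensional ℂ V]
    (Λ : Submodule ℤ V) [DiscreteTopology Λ] [IsZLattice ℝ Λ]
    (E : Polarization Λ)
    {F : Type*} [Ring F] [Algebra ℚ F] (ι : F →ₐ[ℚ] torusEndQ Λ)
    (hA : IsQuaternionType E ι)
    (n : ℕ) (hn : Module.finrank ℂ V = 2 * n) :
    (∀ K K' : Subalgebra ℚ F, IsQuadraticSubfield K → IsQuadraticSubfield K' →
      quaternionClasses ι n K = quaternionClasses ι n K') ∧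
    (∀ K : Subalgebra ℚ F, IsQuadraticSubfield K →
      (∀ w ∈ quaternionClasses ι n K,
        cohQToC Λ (2 * n) w ∈ hodgePiece Λ n n (two_mul n).symm) ∧
      Module.finrank ℚ (quaternionClasses ι n K) = 2 * n + 1) := by
  have := hA.definite.isSimpleRing
  have := hA.definite.isCentral
  exact proposition4p7_general Λ hA.definite.finrank_eq ι n hn
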